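/- Let $d\ge 1$ and let $(X,Y),(X_1,Y_1),(X_2,Y_2),\dots$ be i.i.d. random pairs with values in $\mathbb R^d\times\{0,1\}$. Let $\mu$ be the law of $X$, let $\eta(x)=\mathbb E(Y\mid X=x)$ be (a version of) the conditional mean and $v(x)=\operatorname{var}(Y\mid X=x)$ (a version of) the conditional variance function. Assume that * $\mu$ is the uniform distribution on a compact convex subset of $\mathbb R^d$ with non-empty interior, and its support $\operatorname{supp}(\mu)$ is a simple polytope (a polytope each of whose vertices lies on exactly as many edges as its dimension); * there are real constants $A,A'$ and $\alpha,\alpha'>0$ such that $|\eta(x)-\eta(x')|\le A\|x-x'\|^{\alpha}$ and $|v(x)-v(x')|\le A'\|x-x'\|^{\alpha'}$ for all $x,x'\in\operatorname{supp}(\mu)$. Let $T$ be any Delaunay triangulation scheme: to every finite family of points $x_1,\dots,x_n$ that affinely spans $\mathbb R^d$ it assigns a triangulation of $\operatorname{conv}(x_1,\dots,x_n)$ into non-degenerate $d$-simplices with vertices among the $x_i$, any two of which intersect exactly in their common face, and such that the open ball bounded by the circumsphere of each simplex contains none of the $x_i$. Let $\hat\eta=\hat\eta_n$ be the simplicial interpolation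 of $(X_1,Y_1),\dots,(X_n,Y_n)$: on each simplex of the triangulation of $X_1,\dots,X_n$ it is the affine function which takes the values $Y_i$ at the vertices $X_i$ of this simplex, and $\hat\eta(x)=1/2$ for $x\notin\operatorname{conv}(X_1,\dots,X_n)$. Let $\hat f(x)=\mathbf 1\{\hat\eta(x)>1/2\}$ be the plug-in classifier and $f^*(x)=\mathbf 1\{\eta(x)>1/2\}$ the Bayes classifier. For a classifier $f$ let $R(f)=\mathbb P(f(X)\ne Y)$; thus $R(\hat f)$ is the conditional risk of $\hat f$ given the training data. Then $R(\hat f)-R(f^*)$ is an integrable random variable for every $n>d$, and $$\limsup_{n\to\infty}\ \mathbb E\big[R(\hat f)-R(f^*)\big]\ \le\ \sqrt{\frac{8}{d+2}\,\mathbb E\big[(Y-\eta(X))^2\big]}\,.$$ -/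

import Mathlib

open MeasureTheory ProbabilityTheory Filter

noncomputable section

namespace SimplicialRisk

/-- `Pt d` is `ℝ^d` with the Euclidean norm. -/
abbrev Pt (d : ℕ) : Type := EuclideanSpace ℝ (Fin d)

/-- `(A, α)`-smoothness (Hölder) of `g` on the support of `μ`. -/
def IsSmoothOnSupport {d : ℕ} (μ : Measure (Pt d)) (g : Pt d → ℝ) (A α : ℝ) : Prop :=
  ∀ x ∈ μ.support, ∀ x' ∈ μ.support, |g x - g x'| ≤ A * ‖x - x'‖ ^ α

/-- A simple polytope: the convex hull of a finite set, each of whose vertices lies on exactly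
as many edges (one-dimensional faces) as the dimension of the polytope. -/
def IsSimplePolytope {d : ℕ} (C : Set (Pt d)) : Prop :=
  (∃ V : Finset (Pt d), C = convexHull ℝ (V : Set (Pt d))) ∧
    ∀ v ∈ C.extremePoints ℝ,
      {F : Set (Pt d) | IsExposed ℝ C F ∧ v ∈ F ∧
        Module.finrank ℝ (vectorSpan ℝ F) = 1}.ncard = Module.finrank ℝ (vectorSpan ℝ C)

/-- The convex hull of the points `x i`, `i ∈ s`. -/
def hull {d n : ℕ} (x : Fin n → Pt d) (s : Finset (Fin n)) : Set (Pt d) :=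
  convexHull ℝ (x '' (s : Set (Fin n)))

/-- `T`, a finite collection of index sets, is a triangulation of the convex hull of the points
`x 0, …, x (n - 1)` into non-degenerate simplices with vertices at these points; any two of the
simplices intersect exactly in their common face. -/
structure IsTriangulation {d n : ℕ} (x : Fin n → Pt d) (T : Finset (Finset (Fin n))) : Prop where
  card_eq : ∀ s ∈ T, s.card = d + 1
  nondegenerate : ∀ s ∈ T, AffineIndependent ℝ (fun i : s => x i)
  cover : (⋃ s ∈ T, hull x s) = convexHull ℝ (Set.range x)
  inter_face : ∀ s ∈ T, ∀ t ∈ T, hull x s ∩ hull x t = hull x (s ∩ t)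

/-- A Delaunay triangulation: a triangulation such that the open ball bounded by the circumsphere
of any of its simplices contains none of the points. -/
structure IsDelaunay {d n : ℕ} (x : Fin n → Pt d) (T : Finset (Finset (Fin n))) : Prop
    extends IsTriangulation x T where
  empty_ball : ∀ s ∈ T, ∃ (c : Pt d) (r : ℝ),
    (∀ i ∈ s, dist (x i) c = r) ∧ ∀ j, r ≤ dist (x j) c

/-- A Delaunay triangulation scheme: a rule which assigns a Delaunay triangulation to every finite
family of points that spans `ℝ^d`. -/
def IsDelaunayScheme {d : ℕ} (T : (n : ℕ) → (Fin n → Pt d) → Finset (Finset (Fin n))) : Prop :=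
  ∀ (n : ℕ) (x : Fin n → Pt d), affineSpan ℝ (Set.range x) = ⊤ → IsDelaunay x (T n x)

open Classical in
/-- The linear (affine) interpolation of `(x i, y i)`, `i ∈ s`, evaluated at `z`: the value
`β₀ + ⟨z, β⟩`, where `(β₀, β)` solves `β₀ + ⟨x i, β⟩ = y i` for `i ∈ s`. The solution exists and is
unique when the `x i`, `i ∈ s`, are the `d + 1` vertices of a non-degenerate simplex, which is the
only case in which this is used. -/
def linearInterp {d n : ℕ} (s : Finset (Fin n)) (x : Fin n → Pt d) (y : Fin n → ℝ)
    (z : Pt d) : ℝ :=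
  if h : ∃ β : ℝ × Pt d, ∀ i ∈ s, β.1 + inner ℝ (x i) β.2 = y i then
    h.choose.1 + inner ℝ z h.choose.2
  else 0

open Classical in
/-- Simplicial interpolation of the data `(x i, y i)` with respect to the triangulation `T`: at a
point of a simplex of `T` it is the linear interpolation on this simplex (any of them, if there
are several); at a point in no simplex, it is `1 / 2`. -/
def simplicialInterp {d n : ℕ} (T : Finset (Finset (Fin n))) (x : Fin n → Pt d)
    (y : Fin n → ℝ) (z : Pt d) : ℝ :=
  if h : ∃ s ∈ T, z ∈ hull x s then linearInterp h.choose x y z else 1 / 2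

open Classical in
/-- The plug-in classifier `z ↦ 1{g z > 1/2}`. -/
def plugIn {d : ℕ} (g : Pt d → ℝ) (z : Pt d) : ℝ :=
  if 1 / 2 < g z then 1 else 0

/-- The risk `P(f(X) ≠ Y)` of a classifier `f` under zero-one loss. -/
def risk {Ω : Type*} [MeasurableSpace Ω] (P : Measure Ω) {d : ℕ} (X : Ω → Pt d) (Y : Ω → ℝ)
    (f : Pt d → ℝ) : ℝ :=
  P.real {ω | f (X ω) ≠ Y ω}

/-- The plug-in classifier based on simplicial interpolation of the training examples
`(X 1, Y 1), …, (X n, Y n)`, at the outcome `ω`. -/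
def simplicialClassifier {Ω : Type*} {d : ℕ}
    (T : (n : ℕ) → (Fin n → Pt d) → Finset (Finset (Fin n)))
    (X : ℕ → Ω → Pt d) (Y : ℕ → Ω → ℝ) (n : ℕ) (ω : Ω) : Pt d → ℝ :=
  plugIn (simplicialInterp (T n fun i => X (i + 1) ω) (fun i => X (i + 1) ω)
    (fun i => Y (i + 1) ω))

end SimplicialRisk

end

/-
For points in general position a Delaunay triangulation is forced: its simplices are exactly the
`(d + 1)`-subsets whose circumscribed ball is empty (lift the points to the paraboloid
`z ↦ (z, ‖z‖²)`). Hence, off a null set, simplicial interpolation is a measurable function of the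
data which does not depend on the scheme: `η̂ z = ∑ λₖ Yₖ`, with `λ` the barycentric coordinates
of `z` in its cell.

The excess risk of a plug-in classifier is at most twice the `L¹` distance of `η̂` to `η`, hence at
most `2 √MSE`. Given the design, the labels are uncorrelated, so the squared error splits into a
squared bias, which is small as soon as the cell is small, and the variance `∑ λₖ² σ²(Xₖ)`. The
variance is integrated cell by cell: the mean of `∑ λₖ²` over a simplex is `2 / (d + 2)`. An empty
circumball through a small neighbourhood of an interior point cannot be large, since every ball of a
finite net around that point eventually contains an observation; so the cells there shrink.
-/

noncomputable section

open scoped Topology ENNReal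

namespace SimplicialRisk

variable {d n : ℕ}

/-- The affine basis formed by the vertices of a non-degenerate simplex in `ℝ^d`. -/
def vertexBasis {p : Fin (d + 1) → Pt d} (hp : AffineIndependent ℝ p) :
    AffineBasis (Fin (d + 1)) ℝ (Pt d) :=
  ⟨p, hp, hp.affineSpan_eq_top_iff_card_eq_finrank_add_one.2 (by simp)⟩

/-- Some affine basis of `ℝ^d`, with respect to which barycentric coordinates are computed. -/
def referenceBasis (d : ℕ) : AffineBasis (Fin (d + 1)) ℝ (Pt d) :=
  (AffineBasis.exists_affineBasis_of_finiteDimensional (by simp)).some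

/-- The barycentric coordinates of `z` with respect to the points `p k`. They are defined through a
change of basis from a fixed reference basis, so as to be jointly measurable in `p` and `z`; they
are meaningful when the `p k` are affinely independent. -/
def bary (p : Fin (d + 1) → Pt d) (z : Pt d) : Fin (d + 1) → ℝ :=
  Matrix.vecMul ((referenceBasis d).coords z) ((referenceBasis d).toMatrix p)⁻¹

section Barycentric

variable {p : Fin (d + 1) → Pt d} (hp : AffineIndependent ℝ p)

include hp

lemma bary_eq_coord (z : Pt d) (k : Fin (d + 1)) : bary p z k = (vertexBasis hp).coord k z :=
  congrFun ((referenceBasis d).toMatrix_inv_vecMul_toMatrix (vertexBasis hp) z) k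

lemma sum_bary (z : Pt d) : ∑ k, bary p z k = 1 := by
  simpa only [bary_eq_coord hp] using (vertexBasis hp).sum_coord_apply_eq_one z

lemma sum_bary_mul_affineMap (f : Pt d →ᵃ[ℝ] ℝ) (z : Pt d) :
    ∑ k, bary p z k * f (p k) = f z := by
  have hsum := (vertexBasis hp).sum_coord_apply_eq_one z
  conv_rhs => rw [← (vertexBasis hp).affineCombination_coord_eq_self z,
    Finset.map_affineCombination _ _ _ hsum,
    Finset.affineCombination_eq_linear_combination _ _ _ hsum]
  simp only [bary_eq_coord hp, smul_eq_mul]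
  rfl

lemma bary_vertex (j k : Fin (d + 1)) : bary p (p j) k = if k = j then 1 else 0 := by
  rw [bary_eq_coord hp]
  exact (vertexBasis hp).coord_apply k j

lemma exists_affineMap_eq_sum_bary_mul (y : Fin (d + 1) → ℝ) :
    ∃ f : Pt d →ᵃ[ℝ] ℝ, (∀ k, f (p k) = y k) ∧ ∀ z, f z = ∑ k, bary p z k * y k := by
  have apply_eq (z : Pt d) :
      (∑ k, y k • (vertexBasis hp).coord k) z = ∑ k, bary p z k * y k := by
    simp only [bary_eq_coord hp, mul_comm, ← smul_eq_mul]
    exact map_sum (AddMonoidHom.mk' (fun g : Pt d →ᵃ[ℝ] ℝ => g z) fun _ _ => rfl) _ _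
  refine ⟨∑ k, y k • (vertexBasis hp).coord k, fun j => ?_, apply_eq⟩
  simp [apply_eq, bary_vertex hp]

lemma mem_convexHull_iff_bary_nonneg {z : Pt d} :
    z ∈ convexHull ℝ (Set.range p) ↔ ∀ k, 0 ≤ bary p z k := by
  simp only [bary_eq_coord hp]
  exact Set.ext_iff.1 (vertexBasis hp).convexHull_eq_nonneg_coord z

lemma volume_bary_eq_zero (k : Fin (d + 1)) : volume {z | bary p z k = 0} = 0 := by
  have hset : {z | bary p z k = 0} =
      ((AffineSubspace.mk' (0 : ℝ) ⊥).comap ((vertexBasis hp).coord k) : Set (Pt d)) := by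
    ext z
    simp [bary_eq_coord hp, AffineSubspace.mem_mk']
  rw [hset]
  refine Measure.addHaar_affineSubspace volume _ fun htop => ?_
  have hmem : p k ∈ {z | bary p z k = 0} := by
    rw [hset, htop]
    trivial
  simp [bary_vertex hp] at hmem

end Barycentric

lemma measurable_bary (k : Fin (d + 1)) :
    Measurable fun q : (Fin (d + 1) → Pt d) × Pt d => bary q.1 q.2 k := by
  have hM : Continuous fun q : (Fin (d + 1) → Pt d) × Pt d => (referenceBasis d).toMatrix q.1 :=
    continuous_matrix fun i j => ((referenceBasis d).coord j).continuous_of_finiteDimensional.comp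
      ((continuous_apply i).comp continuous_fst)
  have hcoords : Continuous fun q : (Fin (d + 1) → Pt d) × Pt d => (referenceBasis d).coords q.2 :=
    (referenceBasis d).coords.continuous_of_finiteDimensional.comp continuous_snd
  have hnum := (continuous_apply k).comp (hcoords.matrix_vecMul hM.matrix_adjugate)
  simp only [bary, Matrix.inv_def, Matrix.vecMul_smul, Pi.smul_apply, Ring.inverse_eq_inv',
    smul_eq_mul]
  exact hM.matrix_det.measurable.inv.mul hnum.measurable

lemma exists_affineMap_eq_add_inner {E : Type*} [NormedAddCommGroup E] [InnerProductSpace ℝ E]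
    [FiniteDimensional ℝ E] (f : E →ᵃ[ℝ] ℝ) :
    ∃ (a : ℝ) (b : E), ∀ z, f z = a + inner ℝ z b := by
  obtain ⟨b, hb⟩ := (InnerProductSpace.toDual ℝ E).surjective f.linear.toContinuousLinearMap
  refine ⟨f 0, b, fun z => ?_⟩
  have hlinear : inner ℝ b z = f.linear z := by
    rw [← InnerProductSpace.toDual_apply_apply, hb]
    rfl
  rw [real_inner_comm, hlinear, f.decomp]
  simp [add_comm]

lemma sum_bary_mul_add_inner {p : Fin (d + 1) → Pt d} (hp : AffineIndependent ℝ p) (a : ℝ)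
    (b z : Pt d) : ∑ k, bary p z k * (a + inner ℝ (p k) b) = a + inner ℝ z b :=
  sum_bary_mul_affineMap hp
    (AffineMap.const ℝ (Pt d) a + ((innerₗ (Pt d)).flip b).toAffineMap) z

section Vertices

variable {x : Fin n → Pt d} {s : Fin (d + 1) ↪o Fin n} {t : Finset (Fin n)}

lemma hull_eq_convexHull_range (hst : Set.range s = t) :
    hull x t = convexHull ℝ (Set.range (x ∘ s)) := by
  rw [hull, ← hst, Set.range_comp]

lemma mem_hull_iff_bary_nonneg (hst : Set.range s = t) (hs : AffineIndependent ℝ (x ∘ s))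
    {z : Pt d} : z ∈ hull x t ↔ ∀ k, 0 ≤ bary (x ∘ s) z k := by
  rw [hull_eq_convexHull_range hst, mem_convexHull_iff_bary_nonneg hs]

lemma linearInterp_eq_sum_bary_mul (hst : Set.range s = t) (hs : AffineIndependent ℝ (x ∘ s))
    (y : Fin n → ℝ) (z : Pt d) :
    linearInterp t x y z = ∑ k, bary (x ∘ s) z k * y (s k) := by
  have mem_t (k) : s k ∈ t := by
    rw [← Finset.mem_coe, ← hst]
    exact Set.mem_range_self k
  have hex : ∃ β : ℝ × Pt d, ∀ i ∈ t, β.1 + inner ℝ (x i) β.2 = y i := by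
    obtain ⟨f, hf, -⟩ := exists_affineMap_eq_sum_bary_mul hs (y ∘ s)
    obtain ⟨a, b, hab⟩ := exists_affineMap_eq_add_inner f
    refine ⟨(a, b), fun i hi => ?_⟩
    obtain ⟨k, rfl⟩ : i ∈ Set.range s := hst ▸ hi
    rw [← hab]
    exact hf k
  rw [linearInterp, dif_pos hex, ← sum_bary_mul_add_inner hs]
  exact Finset.sum_congr rfl fun k _ => congrArg _ (hex.choose_spec _ (mem_t k))

end Vertices

/-- The affine function which agrees with `‖·‖²` at the points `p k`. It lies below `‖·‖²` exactly
outside the open ball bounded by the sphere through these points, which turns the Delaunay condition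
into a system of polynomial inequalities. -/
def paraboloidLift (p : Fin (d + 1) → Pt d) (z : Pt d) : ℝ := ∑ k, bary p z k * ‖p k‖ ^ 2

/-- `z` lies in the interior of the non-degenerate simplex with vertices `x (s k)`, and the open
ball bounded by the circumsphere of this simplex contains none of the points `x j`. The simplex is
encoded by the increasing enumeration `s` of its vertex set. -/
structure IsDelaunayCell (x : Fin n → Pt d) (s : Fin (d + 1) ↪o Fin n) (z : Pt d) : Prop where
  affineIndependent : AffineIndependent ℝ (x ∘ s)
  bary_pos : ∀ k, 0 < bary (x ∘ s) z k
  paraboloidLift_le : ∀ j, paraboloidLift (x ∘ s) (x j) ≤ ‖x j‖ ^ 2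

/-- No `d + 1` of the points lie on a hyperplane, and no `d + 2` on a sphere. -/
structure InGeneralPosition (x : Fin n → Pt d) : Prop where
  affineIndependent : ∀ s : Fin (d + 1) ↪o Fin n, AffineIndependent ℝ (x ∘ s)
  paraboloidLift_ne : ∀ (s : Fin (d + 1) ↪o Fin n) (j : Fin n), j ∉ Set.range s →
    paraboloidLift (x ∘ s) (x j) ≠ ‖x j‖ ^ 2

lemma paraboloidLift_eq_sum_bary_mul {p q : Fin (d + 1) → Pt d} (hp : AffineIndependent ℝ p)
    (hq : AffineIndependent ℝ q) (z : Pt d) :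
    paraboloidLift p z = ∑ k, bary q z k * paraboloidLift p (q k) := by
  obtain ⟨f, -, hf⟩ := exists_affineMap_eq_sum_bary_mul hp fun k => ‖p k‖ ^ 2
  have hlift (u) : paraboloidLift p u = f u := (hf u).symm
  simp only [hlift, sum_bary_mul_affineMap hq]

lemma IsDelaunayCell.mem_convexHull {x : Fin n → Pt d} {s : Fin (d + 1) ↪o Fin n} {z : Pt d}
    (hs : IsDelaunayCell x s z) : z ∈ convexHull ℝ (Set.range (x ∘ s)) :=
  (mem_convexHull_iff_bary_nonneg hs.affineIndependent).2 fun k => (hs.bary_pos k).le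

lemma IsDelaunayCell.paraboloidLift_le_paraboloidLift {x : Fin n → Pt d}
    {s t : Fin (d + 1) ↪o Fin n} {z : Pt d} (hs : IsDelaunayCell x s z)
    (ht : IsDelaunayCell x t z) : paraboloidLift (x ∘ s) z ≤ paraboloidLift (x ∘ t) z := by
  rw [paraboloidLift_eq_sum_bary_mul hs.affineIndependent ht.affineIndependent]
  exact Finset.sum_le_sum fun k _ =>
    mul_le_mul_of_nonneg_left (hs.paraboloidLift_le _) (ht.bary_pos k).le

/-- Two empty simplices over `z` have the same lift at `z`, so each vertex of one lies on the
circumsphere of the other. -/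
lemma InGeneralPosition.isDelaunayCell_unique {x : Fin n → Pt d} (hx : InGeneralPosition x)
    {s t : Fin (d + 1) ↪o Fin n} {z : Pt d} (hs : IsDelaunayCell x s z)
    (ht : IsDelaunayCell x t z) : s = t := by
  have heq : ∑ k, bary (x ∘ t) z k * paraboloidLift (x ∘ s) (x (t k)) =
      ∑ k, bary (x ∘ t) z k * ‖x (t k)‖ ^ 2 :=
    (paraboloidLift_eq_sum_bary_mul hs.affineIndependent ht.affineIndependent z).symm.trans
      ((hs.paraboloidLift_le_paraboloidLift ht).antisymm (ht.paraboloidLift_le_paraboloidLift hs))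
  rw [Finset.sum_eq_sum_iff_of_le fun k _ =>
    mul_le_mul_of_nonneg_left (hs.paraboloidLift_le _) (ht.bary_pos k).le] at heq
  have hrange : Set.range t ⊆ Set.range s := by
    rintro _ ⟨k, rfl⟩
    by_contra hk
    exact hx.paraboloidLift_ne s (t k) hk
      (mul_left_cancel₀ (ht.bary_pos k).ne' (heq k (Finset.mem_univ k)))
  have hncard (u : Fin (d + 1) ↪o Fin n) : (Set.range u).ncard = d + 1 := by
    rw [← Set.image_univ, Set.ncard_image_of_injective _ u.injective, Set.ncard_univ, Nat.card_fin]
  exact DFunLike.coe_injective ((s.strictMono.range_inj t.strictMono).1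
    (Set.eq_of_subset_of_ncard_le hrange (by rw [hncard, hncard])).symm)

section Measurability

lemma measurable_paraboloidLift :
    Measurable fun q : (Fin (d + 1) → Pt d) × Pt d => paraboloidLift q.1 q.2 :=
  Finset.measurable_sum _ fun k _ => (measurable_bary k).mul (by fun_prop)

lemma measurable_bary_comp (s : Fin (d + 1) ↪o Fin n) (k : Fin (d + 1)) :
    Measurable fun q : (Fin n → Pt d) × Pt d => bary (q.1 ∘ s) q.2 k :=
  (measurable_bary k).comp (f := fun q : (Fin n → Pt d) × Pt d => (q.1 ∘ s, q.2)) (by fun_prop)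

lemma measurable_paraboloidLift_comp (s : Fin (d + 1) ↪o Fin n) (j : Fin n) :
    Measurable fun x : Fin n → Pt d => paraboloidLift (x ∘ s) (x j) :=
  measurable_paraboloidLift.comp (f := fun x : Fin n → Pt d => (x ∘ s, x j)) (by fun_prop)

lemma measurableSet_affineIndependent_comp {ι κ : Type*} [Finite ι] (s : ι → κ) :
    MeasurableSet {x : κ → Pt d | AffineIndependent ℝ (x ∘ s)} :=
  isOpen_setOfPred_affineIndependent.measurableSet.preimage (f := fun x : κ → Pt d => x ∘ s)
    (by fun_prop)

lemma measurableSet_isDelaunayCell (s : Fin (d + 1) ↪o Fin n) :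
    MeasurableSet {q : (Fin n → Pt d) × Pt d | IsDelaunayCell q.1 s q.2} := by
  have hcell (q : (Fin n → Pt d) × Pt d) : IsDelaunayCell q.1 s q.2 ↔
      AffineIndependent ℝ (q.1 ∘ s) ∧ (∀ k, 0 < bary (q.1 ∘ s) q.2 k) ∧
        ∀ j, paraboloidLift (q.1 ∘ s) (q.1 j) ≤ ‖q.1 j‖ ^ 2 :=
    ⟨fun h => ⟨h.1, h.2, h.3⟩, fun h => ⟨h.1, h.2.1, h.2.2⟩⟩
  simp only [hcell, measurableSet_setOfPred]
  refine (measurableSet_setOfPred.1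
    ((measurableSet_affineIndependent_comp s).preimage measurable_fst)).and
    ((Measurable.forall fun k => ?_).and (Measurable.forall fun j => ?_))
  · exact measurableSet_setOfPred.1 (measurableSet_lt measurable_const (measurable_bary_comp s k))
  · exact measurableSet_setOfPred.1 (measurableSet_le
      ((measurable_paraboloidLift_comp s j).comp measurable_fst) (by fun_prop))

end Measurability

section GeneralPosition

variable {ι : Type*} [Fintype ι]

lemma ae_of_forall_ae_update [DecidableEq ι] {p : (ι → Pt d) → Prop} (hp : Measurable p) (i : ι)
    (h : ∀ x, ∀ᵐ u, p (Function.update x i u)) : ∀ᵐ x, p x := by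
  refine ae_mem_of_ae_add_linearMap_mem (LinearMap.single ℝ (fun _ : ι => Pt d) i)
    (μ := volume) volume (measurableSet_setOfPred.2 hp) fun x => ?_
  filter_upwards [(quasiMeasurePreserving_add_left volume (x i)).ae (h x)] with u hu
  have hupdate : x + LinearMap.single ℝ (fun _ : ι => Pt d) i u =
      Function.update x i (x i + u) := by
    ext j : 1
    rcases eq_or_ne j i with rfl | hj <;> simp [*]
  exact hupdate ▸ hu

/-- A new point avoids the lower-dimensional span of the previous ones. -/
lemma ae_affineIndependent_comp {m : ℕ} (hm : m ≤ d + 1) (s : Fin m ↪ ι) :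
    ∀ᵐ x : ι → Pt d, AffineIndependent ℝ (x ∘ s) := by
  classical
  induction m with
  | zero => exact Eventually.of_forall fun x => affineIndependent_of_subsingleton ℝ _
  | succ m ih =>
    have hnew : ∀ᵐ x : ι → Pt d, AffineIndependent ℝ (x ∘ s ∘ Fin.succ) →
        AffineIndependent ℝ (x ∘ s) := by
      refine ae_of_forall_ae_update ((measurableSet_setOfPred.1
        (measurableSet_affineIndependent_comp _)).imp (measurableSet_setOfPred.1
        (measurableSet_affineIndependent_comp _))) (s 0) fun x => ?_
      have hupdate (u : Pt d) : Function.update x (s 0) u ∘ s ∘ Fin.succ = x ∘ s ∘ Fin.succ :=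
        Function.update_comp_eq_of_notMem_range _ _ (by simp)
      by_cases hind : AffineIndependent ℝ (x ∘ s ∘ Fin.succ)
      · have hspan : affineSpan ℝ (Set.range (x ∘ s ∘ Fin.succ)) ≠ ⊤ := fun htop => by
          have hcard := hind.affineSpan_eq_top_iff_card_eq_finrank_add_one.1 htop
          simp only [Fintype.card_fin, finrank_euclideanSpace] at hcard
          omega
        filter_upwards [measure_eq_zero_iff_ae_notMem.1
          (Measure.addHaar_affineSubspace volume _ hspan)] with u hu _
        refine AffineIndependent.affineIndependent_of_notMem_span (i := 0) ?_ ?_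
        · rw [← affineIndependent_equiv (finSuccAboveEquiv 0)]
          exact (hupdate u).symm ▸ hind
        · have himage : (Function.update x (s 0) u ∘ s) '' {k | k ≠ 0} =
              Set.range (x ∘ s ∘ Fin.succ) := by
            rw [← hupdate u, ← Function.comp_assoc, Set.range_comp _ Fin.succ, Fin.range_succ]
            rfl
          rw [himage]
          simpa using hu
      · exact Eventually.of_forall fun u h => absurd (hupdate u ▸ h) hind
    filter_upwards [ih (by omega) ((Fin.succEmb m).trans s), hnew] with x hx hx'
    exact hx' hx

lemma volume_affineMap_eq_norm_sq_eq_zero (hd : 1 ≤ d) (f : Pt d →ᵃ[ℝ] ℝ) :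
    volume {u : Pt d | f u = ‖u‖ ^ 2} = 0 := by
  have : Nonempty (Fin d) := ⟨⟨0, hd⟩⟩
  obtain ⟨a, b, hab⟩ := exists_affineMap_eq_add_inner f
  refine measure_mono_null (fun u hu => ?_)
    (Measure.addHaar_sphere volume ((2⁻¹ : ℝ) • b) (√(a + ‖b‖ ^ 2 / 4)))
  have hnorm : ‖u - (2⁻¹ : ℝ) • b‖ ^ 2 = a + ‖b‖ ^ 2 / 4 := by
    rw [norm_sub_sq_real, ← (show f u = ‖u‖ ^ 2 from hu), hab, inner_smul_right, norm_smul]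
    norm_num
    ring
  rw [mem_sphere_iff_norm, ← hnorm, Real.sqrt_sq (norm_nonneg _)]

lemma ae_paraboloidLift_ne (hd : 1 ≤ d) (s : Fin (d + 1) ↪o Fin n) {j : Fin n}
    (hj : j ∉ Set.range s) : ∀ᵐ x : Fin n → Pt d, AffineIndependent ℝ (x ∘ s) →
      paraboloidLift (x ∘ s) (x j) ≠ ‖x j‖ ^ 2 := by
  refine ae_of_forall_ae_update ((measurableSet_setOfPred.1
    (measurableSet_affineIndependent_comp s)).imp (measurableSet_setOfPred.1
    (measurableSet_eq_fun (measurable_paraboloidLift_comp s j) (by fun_prop)).compl)) j fun x => ?_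
  have hupdate (u : Pt d) : Function.update x j u ∘ s = x ∘ s :=
    Function.update_comp_eq_of_notMem_range _ _ hj
  simp only [hupdate, Function.update_self]
  by_cases hind : AffineIndependent ℝ (x ∘ s)
  · obtain ⟨f, -, hf⟩ := exists_affineMap_eq_sum_bary_mul hind fun k => ‖x (s k)‖ ^ 2
    filter_upwards [measure_eq_zero_iff_ae_notMem.1
      (volume_affineMap_eq_norm_sq_eq_zero hd f)] with u hu _ heq
    exact hu ((hf u).trans heq)
  · exact Eventually.of_forall fun u h => absurd h hind

lemma ae_inGeneralPosition (hd : 1 ≤ d) (n : ℕ) :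
    ∀ᵐ x : Fin n → Pt d, InGeneralPosition x := by
  have hind : ∀ᵐ x : Fin n → Pt d, ∀ s : Fin (d + 1) ↪o Fin n, AffineIndependent ℝ (x ∘ s) :=
    ae_all_iff.2 fun s => ae_affineIndependent_comp le_rfl s.toEmbedding
  have hsphere : ∀ᵐ x : Fin n → Pt d, ∀ (s : Fin (d + 1) ↪o Fin n) (j : Fin n),
      j ∉ Set.range s → AffineIndependent ℝ (x ∘ s) →
        paraboloidLift (x ∘ s) (x j) ≠ ‖x j‖ ^ 2 :=
    ae_all_iff.2 fun s => ae_all_iff.2 fun j => ae_all_iff.2 fun hj => ae_paraboloidLift_ne hd s hj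
  filter_upwards [hind, hsphere] with x hx hx'
  exact ⟨hx, fun s j hj => hx' s j hj (hx s)⟩

end GeneralPosition

/-- The interior of the simplex with vertices `p k`. -/
def openSimplex (p : Fin (d + 1) → Pt d) : Set (Pt d) := {z | ∀ k, 0 < bary p z k}

lemma integral_one_sub_pow_mul (m : ℕ) :
    ∫ t in (0 : ℝ)..1, (1 - t) ^ m * (2 * t) = 2 / ((m + 1) * (m + 2)) := by
  have hsubst := intervalIntegral.integral_comp_sub_left (a := 0) (b := 1)
    (fun u : ℝ => u ^ m * (2 * (1 - u))) 1
  simp only [sub_sub_cancel, sub_self, sub_zero] at hsubst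
  have hexpand (u : ℝ) : u ^ m * (2 * (1 - u)) = 2 * u ^ m - 2 * u ^ (m + 1) := by ring
  simp only [hsubst, hexpand]
  rw [intervalIntegral.integral_sub (Continuous.intervalIntegrable (by fun_prop) _ _)
      (Continuous.intervalIntegrable (by fun_prop) _ _),
    intervalIntegral.integral_const_mul, intervalIntegral.integral_const_mul, integral_pow,
    integral_pow]
  push_cast
  field_simp
  simp
  ring

section OpenSimplex

variable {p : Fin (d + 1) → Pt d} (hp : AffineIndependent ℝ p)

include hp

lemma continuous_bary (k : Fin (d + 1)) : Continuous fun z => bary p z k := by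
  simp only [bary_eq_coord hp]
  exact ((vertexBasis hp).coord k).continuous_of_finiteDimensional

lemma measurableSet_openSimplex : MeasurableSet (openSimplex p) :=
  measurableSet_setOfPred.2 (Measurable.forall fun k => measurableSet_setOfPred.1
    (measurableSet_lt measurable_const (continuous_bary hp k).measurable))

lemma openSimplex_subset_convexHull : openSimplex p ⊆ convexHull ℝ (Set.range p) :=
  fun _ hz => (mem_convexHull_iff_bary_nonneg hp).2 fun k => (hz k).le

lemma volume_openSimplex_ne_top : volume (openSimplex p) ≠ ∞ :=
  ((isBounded_convexHull.2 (Set.finite_range p).isBounded).subset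
    (openSimplex_subset_convexHull hp)).measure_lt_top.ne

lemma bary_le_one_of_mem_openSimplex {z : Pt d} (hz : z ∈ openSimplex p) (k : Fin (d + 1)) :
    bary p z k ≤ 1 := by
  rw [← sum_bary hp z]
  exact Finset.single_le_sum (fun l _ => (hz l).le) (Finset.mem_univ k)

lemma bary_homothety (c z : Pt d) (r : ℝ) (k : Fin (d + 1)) :
    bary p (AffineMap.homothety c r z) k = (1 - r) * bary p c k + r * bary p z k := by
  rw [bary_eq_coord hp, bary_eq_coord hp, bary_eq_coord hp, AffineMap.homothety_eq_lineMap,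
    AffineMap.apply_lineMap, AffineMap.lineMap_apply_ring]

lemma image_homothety_openSimplex (k : Fin (d + 1)) {t : ℝ} (ht0 : 0 ≤ t) (ht1 : t < 1) :
    AffineMap.homothety (p k) (1 - t) '' openSimplex p =
      {z | t < bary p z k} ∩ openSimplex p := by
  have h1t : 0 < 1 - t := sub_pos.2 ht1
  ext z
  constructor
  · rintro ⟨u, hu, rfl⟩
    have hpos (l) : 0 < (1 - t) * bary p u l := mul_pos h1t (hu l)
    constructor
    · simpa [bary_homothety hp, bary_vertex hp] using hpos k
    · intro l
      rw [bary_homothety hp, bary_vertex hp]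
      split_ifs <;> linarith [hpos l]
  · rintro ⟨hk, hz⟩
    refine ⟨AffineMap.homothety (p k) (1 - t)⁻¹ z, fun l => ?_, ?_⟩
    · have hcoord : bary p (AffineMap.homothety (p k) (1 - t)⁻¹ z) l =
          (1 - t)⁻¹ * (bary p z l - t * bary p (p k) l) := by
        rw [bary_homothety hp]
        field_simp
        ring
      rw [hcoord, bary_vertex hp]
      refine mul_pos (inv_pos.2 h1t) ?_
      split_ifs with hl
      · simpa [hl] using hk
      · simpa using hz l
    · rw [← AffineMap.comp_apply, ← AffineMap.homothety_mul, mul_inv_cancel₀ h1t.ne']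
      simp

lemma volume_lt_bary_inter_openSimplex (k : Fin (d + 1)) {t : ℝ} (ht0 : 0 ≤ t) (ht1 : t < 1) :
    volume ({z | t < bary p z k} ∩ openSimplex p) =
      ENNReal.ofReal ((1 - t) ^ d) * volume (openSimplex p) := by
  rw [← image_homothety_openSimplex hp k ht0 ht1, Measure.addHaar_image_homothety,
    finrank_euclideanSpace_fin, abs_of_nonneg (pow_nonneg (sub_nonneg.2 ht1.le) d)]

lemma lintegral_openSimplex_bary_sq (k : Fin (d + 1)) :
    ∫⁻ z in openSimplex p, ENNReal.ofReal (bary p z k ^ 2) =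
      ENNReal.ofReal (2 / ((d + 1) * (d + 2))) * volume (openSimplex p) := by
  have superlevel {t : ℝ} (ht : t ∈ Set.Ioi 0) :
      volume.restrict (openSimplex p) {z | t < bary p z k} * ENNReal.ofReal (2 * t) =
        (Set.Ioo 0 1).indicator
          (fun t => ENNReal.ofReal ((1 - t) ^ d * (2 * t)) * volume (openSimplex p)) t := by
    rw [Measure.restrict_apply
      (measurableSet_lt measurable_const (continuous_bary hp k).measurable)]
    rcases lt_or_ge t 1 with ht1 | ht1
    · rw [volume_lt_bary_inter_openSimplex hp k (le_of_lt ht) ht1,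
        Set.indicator_of_mem (Set.mem_Ioo.2 ⟨ht, ht1⟩),
        ENNReal.ofReal_mul (pow_nonneg (sub_nonneg.2 ht1.le) d), mul_right_comm]
    · have hempty : {z | t < bary p z k} ∩ openSimplex p = ∅ :=
        Set.eq_empty_of_forall_notMem fun z hz =>
          ((bary_le_one_of_mem_openSimplex hp hz.2 k).trans ht1).not_gt hz.1
      rw [hempty, measure_empty, zero_mul, Set.indicator_of_notMem fun h => ht1.not_gt h.2]
  have hint (b : ℝ) : ∫ t in (0 : ℝ)..b, 2 * t = b ^ 2 := by
    rw [intervalIntegral.integral_const_mul, integral_id]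
    ring
  have layer_cake := lintegral_comp_eq_lintegral_meas_lt_mul (volume.restrict (openSimplex p))
    (f := fun z => bary p z k) (g := fun t => 2 * t)
    (ae_restrict_of_forall_mem (measurableSet_openSimplex hp) fun z hz => (hz k).le)
    (continuous_bary hp k).aemeasurable
    (fun t _ => Continuous.intervalIntegrable (by fun_prop) _ _)
    (ae_restrict_of_forall_mem measurableSet_Ioi fun t ht => by
      simpa using le_of_lt ht)
  simp only [hint] at layer_cake
  rw [layer_cake, setLIntegral_congr_fun measurableSet_Ioi fun t ht => superlevel ht,
    lintegral_indicator measurableSet_Ioo, Measure.restrict_restrict measurableSet_Ioo,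
    Set.inter_eq_left.2 Set.Ioo_subset_Ioi_self,
    lintegral_mul_const' _ _ (volume_openSimplex_ne_top hp), ← integral_one_sub_pow_mul,
    intervalIntegral.integral_of_le zero_le_one, integral_Ioc_eq_integral_Ioo,
    ofReal_integral_eq_lintegral_ofReal]
  · exact (Continuous.integrableOn_Icc (by fun_prop)).mono_set Set.Ioo_subset_Icc_self
  · exact ae_restrict_of_forall_mem measurableSet_Ioo fun t ht =>
      mul_nonneg (pow_nonneg (sub_nonneg.2 ht.2.le) d) (by linarith [ht.1])

lemma integral_openSimplex_bary_sq (k : Fin (d + 1)) :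
    ∫ z in openSimplex p, bary p z k ^ 2 =
      2 / ((d + 1) * (d + 2)) * volume.real (openSimplex p) := by
  rw [integral_eq_lintegral_of_nonneg_ae (Eventually.of_forall fun z => sq_nonneg _)
    ((continuous_bary hp k).pow 2).aestronglyMeasurable, lintegral_openSimplex_bary_sq hp,
    ENNReal.toReal_mul, ENNReal.toReal_ofReal (by positivity), measureReal_def]

/-- Replace each `v (p k)` by the nearby values of `v` in the simplex; the barycentric coordinates
then enter only through their second moments. -/
lemma integral_openSimplex_sum_bary_sq_mul_le {v : Pt d → ℝ} {ε : ℝ}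
    (hv : IntegrableOn v (openSimplex p)) (hvε : ∀ k, ∀ z ∈ openSimplex p, v (p k) ≤ v z + ε) :
    ∫ z in openSimplex p, ∑ k, bary p z k ^ 2 * v (p k) ≤
      2 / (d + 2) * ∫ z in openSimplex p, (v z + ε) := by
  have hfinite := volume_openSimplex_ne_top hp
  have hconst (c : ℝ) : IntegrableOn (fun _ => c) (openSimplex p) := integrableOn_const hfinite
  have hbary (k) : IntegrableOn (fun z => bary p z k ^ 2 * v (p k)) (openSimplex p) := by
    refine Integrable.mul_const ((hconst 1).mono'
      ((continuous_bary hp k).pow 2).aestronglyMeasurable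
      (ae_restrict_of_forall_mem (measurableSet_openSimplex hp) fun z hz => ?_)) _
    rw [Pi.pow_apply, Real.norm_of_nonneg (sq_nonneg _)]
    exact pow_le_one₀ (hz k).le (bary_le_one_of_mem_openSimplex hp hz k)
  have hvertex (k) : volume.real (openSimplex p) * v (p k) ≤ ∫ z in openSimplex p, (v z + ε) := by
    rw [← smul_eq_mul, ← setIntegral_const]
    exact setIntegral_mono_on (hconst _) (hv.add (hconst ε)) (measurableSet_openSimplex hp) (hvε k)
  calc ∫ z in openSimplex p, ∑ k, bary p z k ^ 2 * v (p k)
      = ∑ k, 2 / ((d + 1) * (d + 2)) * (volume.real (openSimplex p) * v (p k)) := by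
        rw [integral_finsetSum _ fun k _ => hbary k]
        simp only [integral_mul_const, integral_openSimplex_bary_sq hp, mul_assoc]
    _ ≤ ∑ _k : Fin (d + 1), 2 / ((d + 1) * (d + 2)) * ∫ z in openSimplex p, (v z + ε) :=
        Finset.sum_le_sum fun k _ => mul_le_mul_of_nonneg_left (hvertex k) (by positivity)
    _ = 2 / (d + 2) * ∫ z in openSimplex p, (v z + ε) := by
        rw [Finset.sum_const, Finset.card_univ, Fintype.card_fin, nsmul_eq_mul]
        push_cast
        field_simp

end OpenSimplex

/-- The power of the point `u` with respect to the circumsphere. -/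
lemma norm_sq_sub_paraboloidLift {p : Fin (d + 1) → Pt d} (hp : AffineIndependent ℝ p) {c : Pt d}
    {r : ℝ} (hc : ∀ k, dist (p k) c = r) (u : Pt d) :
    ‖u‖ ^ 2 - paraboloidLift p u = dist u c ^ 2 - r ^ 2 := by
  have hdist (w : Pt d) : dist w c ^ 2 = ‖w‖ ^ 2 - inner ℝ w ((2 : ℝ) • c) + ‖c‖ ^ 2 := by
    rw [dist_eq_norm, norm_sub_sq_real, inner_smul_right]
  have hvertex (k) : ‖p k‖ ^ 2 = r ^ 2 - ‖c‖ ^ 2 + inner ℝ (p k) ((2 : ℝ) • c) := by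
    rw [← hc k, hdist]
    ring
  rw [paraboloidLift, Finset.sum_congr rfl fun k _ => by rw [hvertex k],
    sum_bary_mul_add_inner hp, hdist]
  ring

lemma IsDelaunayCell.exists_empty_circumsphere {x : Fin n → Pt d} {s : Fin (d + 1) ↪o Fin n}
    {z : Pt d} (hs : IsDelaunayCell x s z) :
    ∃ (c : Pt d) (r : ℝ), (∀ k, dist (x (s k)) c = r) ∧ ∀ j, r ≤ dist (x j) c := by
  let S : Affine.Simplex ℝ (Pt d) d := ⟨x ∘ s, hs.affineIndependent⟩
  have hc (k) : dist ((x ∘ s) k) S.circumcenter = S.circumradius :=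
    S.dist_circumcenter_eq_circumradius k
  refine ⟨S.circumcenter, S.circumradius, hc, fun j => ?_⟩
  refine (sq_le_sq₀ S.circumradius_nonneg dist_nonneg).1 (sub_nonneg.1 ?_)
  rw [← norm_sq_sub_paraboloidLift hs.affineIndependent hc]
  exact sub_nonneg.2 (hs.paraboloidLift_le j)

section Delaunay

variable {x : Fin n → Pt d} {T : Finset (Finset (Fin n))} {s : Fin (d + 1) ↪o Fin n}
  {t : Finset (Fin n)} {z : Pt d}

/-- `z` lies on no hyperplane spanned by a facet of a simplex with vertices at the points. -/
def IsOffFacets (x : Fin n → Pt d) (z : Pt d) : Prop :=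
  ∀ (s : Fin (d + 1) ↪o Fin n) (k : Fin (d + 1)), bary (x ∘ s) z k ≠ 0

lemma InGeneralPosition.ae_isOffFacets (hx : InGeneralPosition x) :
    ∀ᵐ z : Pt d, IsOffFacets x z :=
  ae_all_iff.2 fun s => ae_all_iff.2 fun k =>
    measure_eq_zero_iff_ae_notMem.1 (volume_bary_eq_zero (hx.affineIndependent s) k)

lemma measurableSet_isOffFacets :
    MeasurableSet {q : (Fin n → Pt d) × Pt d | IsOffFacets q.1 q.2} :=
  measurableSet_setOfPred.2 (Measurable.forall fun s => Measurable.forall fun k =>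
    measurableSet_setOfPred.1
      (measurableSet_eq_fun (measurable_bary_comp s k) measurable_const).compl)

lemma InGeneralPosition.affineSpan_eq_top (hx : InGeneralPosition x) (hn : d < n) :
    affineSpan ℝ (Set.range x) = ⊤ := by
  have hbasis := (hx.affineIndependent
    (Fin.castLEOrderEmb hn)).affineSpan_eq_top_iff_card_eq_finrank_add_one.2 (by simp)
  exact top_unique (hbasis ▸ affineSpan_mono ℝ (Set.range_comp_subset_range _ x))

lemma IsTriangulation.affineIndependent_comp (hT : IsTriangulation x T) (ht : t ∈ T)
    (hst : Set.range s = t) : AffineIndependent ℝ (x ∘ s) := by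
  have hmem (k) : s k ∈ t := by
    rw [← Finset.mem_coe, ← hst]
    exact Set.mem_range_self k
  let e : Fin (d + 1) ↪ t :=
    ⟨fun k => ⟨s k, hmem k⟩, fun k l hkl => s.injective (congrArg Subtype.val hkl)⟩
  exact (hT.nondegenerate t ht).comp_embedding e

lemma IsTriangulation.exists_range_eq (hT : IsTriangulation x T) (ht : t ∈ T) :
    ∃ s : Fin (d + 1) ↪o Fin n, Set.range s = t :=
  ⟨t.orderEmbOfFin (hT.card_eq t ht), t.range_orderEmbOfFin _⟩

lemma IsDelaunay.isDelaunayCell (hT : IsDelaunay x T) (ht : t ∈ T) (hst : Set.range s = t)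
    (hz : IsOffFacets x z) (hzt : z ∈ hull x t) : IsDelaunayCell x s z := by
  have hind := hT.affineIndependent_comp ht hst
  refine ⟨hind, fun k => ((mem_hull_iff_bary_nonneg hst hind).1 hzt k).lt_of_ne' (hz s k),
    fun j => ?_⟩
  obtain ⟨c, r, hc, hempty⟩ := hT.empty_ball t ht
  have hvertex (k) : dist ((x ∘ s) k) c = r := hc _ (by
    rw [← Finset.mem_coe, ← hst]
    exact Set.mem_range_self k)
  have hr : 0 ≤ r := hvertex 0 ▸ dist_nonneg
  rw [← sub_nonneg, norm_sq_sub_paraboloidLift hind hvertex, sub_nonneg]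
  exact pow_le_pow_left₀ hr (hempty j) 2

lemma IsDelaunay.exists_isDelaunayCell (hT : IsDelaunay x T) (hz : IsOffFacets x z)
    (hmem : z ∈ convexHull ℝ (Set.range x)) : ∃ s, IsDelaunayCell x s z := by
  rw [← hT.cover] at hmem
  obtain ⟨t, ht, hzt⟩ := Set.mem_iUnion₂.1 hmem
  obtain ⟨s, hst⟩ := hT.exists_range_eq ht
  exact ⟨s, hT.isDelaunayCell ht hst hz hzt⟩

end Delaunay

section Interpolation

open Classical in
/-- The weight of the `i`-th observation in the simplicial interpolation at `z`: the barycentric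
coordinate at `x i` of `z` in its Delaunay cell. Points on the boundary of a cell get no weight. -/
def interpWeight (x : Fin n → Pt d) (z : Pt d) (i : Fin n) : ℝ :=
  ∑ s : Fin (d + 1) ↪o Fin n,
    if IsDelaunayCell x s z then ∑ k, if s k = i then bary (x ∘ s) z k else 0 else 0

/-- Simplicial interpolation with respect to the Delaunay cells. In general position it agrees
almost everywhere with simplicial interpolation in any Delaunay triangulation, and it is jointly
measurable in the data and the point `z`. -/
def cellInterp (x : Fin n → Pt d) (y : Fin n → ℝ) (z : Pt d) : ℝ :=
  ∑ i, interpWeight x z i * y i + (1 - ∑ i, interpWeight x z i) / 2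

lemma measurable_interpWeight (i : Fin n) :
    Measurable fun q : (Fin n → Pt d) × Pt d => interpWeight q.1 q.2 i := by
  classical
  refine Finset.measurable_sum _ fun s _ =>
    Measurable.ite (measurableSet_isDelaunayCell s) ?_ measurable_const
  refine Finset.measurable_sum _ fun k _ => ?_
  split_ifs
  · exact measurable_bary_comp s k
  · exact measurable_const

lemma measurable_cellInterp :
    Measurable fun q : ((Fin n → Pt d) × (Fin n → ℝ)) × Pt d => cellInterp q.1.1 q.1.2 q.2 := by
  have hweight (i) : Measurable fun q : ((Fin n → Pt d) × (Fin n → ℝ)) × Pt d =>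
      interpWeight q.1.1 q.2 i :=
    (measurable_interpWeight i).comp
      (f := fun q : ((Fin n → Pt d) × (Fin n → ℝ)) × Pt d => (q.1.1, q.2)) (by fun_prop)
  unfold cellInterp
  fun_prop

variable {x : Fin n → Pt d} {s : Fin (d + 1) ↪o Fin n} {z : Pt d}

lemma interpWeight_eq_zero (h : ∀ s, ¬ IsDelaunayCell x s z) (i : Fin n) :
    interpWeight x z i = 0 := by
  simp [interpWeight, h]

lemma cellInterp_eq_half (h : ∀ s, ¬ IsDelaunayCell x s z) (y : Fin n → ℝ) :
    cellInterp x y z = 1 / 2 := by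
  simp [cellInterp, interpWeight_eq_zero h]

namespace InGeneralPosition

lemma interpWeight_eq (hx : InGeneralPosition x) (hs : IsDelaunayCell x s z) (i : Fin n) :
    interpWeight x z i = ∑ k, if s k = i then bary (x ∘ s) z k else 0 := by
  rw [interpWeight, Finset.sum_eq_single s, if_pos hs]
  · exact fun t _ hts => if_neg fun ht => hts (hx.isDelaunayCell_unique ht hs)
  · exact fun h => absurd (Finset.mem_univ s) h

lemma sum_eq_sum_vertices (hx : InGeneralPosition x) (hs : IsDelaunayCell x s z)
    (F : ℝ → Fin n → ℝ) (hF : ∀ i, F 0 i = 0) :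
    ∑ i, F (interpWeight x z i) i = ∑ k, F (bary (x ∘ s) z k) (s k) := by
  refine (Fintype.sum_of_injective s s.injective _ _ (fun i hi => ?_) fun k => ?_).symm
  · have hne (k) : s k ≠ i := fun h => hi ⟨k, h⟩
    simp [hx.interpWeight_eq hs, hne, hF]
  · simp [hx.interpWeight_eq hs]

lemma sum_interpWeight (hx : InGeneralPosition x) (hs : IsDelaunayCell x s z) :
    ∑ i, interpWeight x z i = 1 :=
  (hx.sum_eq_sum_vertices hs (fun w _ => w) fun _ => rfl).trans (sum_bary hs.affineIndependent z)

lemma interpWeight_nonneg (hx : InGeneralPosition x) (i : Fin n) : 0 ≤ interpWeight x z i := by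
  by_cases hcell : ∃ s, IsDelaunayCell x s z
  · obtain ⟨s, hs⟩ := hcell
    rw [hx.interpWeight_eq hs]
    exact Finset.sum_nonneg fun k _ => ite_nonneg (hs.bary_pos k).le le_rfl
  · exact (interpWeight_eq_zero (not_exists.1 hcell) i).ge

lemma cellInterp_eq (hx : InGeneralPosition x) (hs : IsDelaunayCell x s z) (y : Fin n → ℝ) :
    cellInterp x y z = ∑ i, interpWeight x z i * y i := by
  simp [cellInterp, hx.sum_interpWeight hs]

lemma cellInterp_mem_Icc (hx : InGeneralPosition x) {y : Fin n → ℝ}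
    (hy : ∀ i, y i ∈ Set.Icc (0 : ℝ) 1) (z : Pt d) : cellInterp x y z ∈ Set.Icc (0 : ℝ) 1 := by
  by_cases hcell : ∃ s, IsDelaunayCell x s z
  · obtain ⟨s, hs⟩ := hcell
    rw [hx.cellInterp_eq hs]
    exact (convex_Icc (0 : ℝ) 1).sum_mem (fun i _ => hx.interpWeight_nonneg i)
      (hx.sum_interpWeight hs) fun i _ => hy i
  · rw [cellInterp_eq_half (not_exists.1 hcell)]
    norm_num

end InGeneralPosition

lemma IsDelaunay.simplicialInterp_eq_cellInterp {T : Finset (Finset (Fin n))}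
    (hT : IsDelaunay x T) (hx : InGeneralPosition x) (hz : IsOffFacets x z) (y : Fin n → ℝ) :
    simplicialInterp T x y z = cellInterp x y z := by
  by_cases hmem : ∃ t ∈ T, z ∈ hull x t
  · obtain ⟨ht, hzt⟩ := hmem.choose_spec
    obtain ⟨s, hst⟩ := hT.exists_range_eq ht
    have hs := hT.isDelaunayCell ht hst hz hzt
    rw [simplicialInterp, dif_pos hmem, linearInterp_eq_sum_bary_mul hst hs.affineIndependent,
      hx.cellInterp_eq hs, hx.sum_eq_sum_vertices hs (fun w i => w * y i) fun i => zero_mul _]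
  · rw [simplicialInterp, dif_neg hmem, cellInterp_eq_half]
    intro s hs
    have hconv := convexHull_mono (Set.range_comp_subset_range s x) hs.mem_convexHull
    rw [← hT.cover] at hconv
    obtain ⟨t, ht, hzt⟩ := Set.mem_iUnion₂.1 hconv
    exact hmem ⟨t, ht, hzt⟩

end Interpolation

section SmallCells

/-- Every open ball of radius `ρ` with center within distance `ρ` of `z` contains a point `x i`. -/
def IsDenseNear (x : Fin n → Pt d) (z : Pt d) (ρ : ℝ) : Prop :=
  ∀ c, dist c z ≤ ρ → ∃ i, dist (x i) c < ρ

variable {x : Fin n → Pt d} {z : Pt d} {ρ : ℝ}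

/-- A half-space with `z` on its boundary contains a ball of radius `ρ` which touches `z`. -/
lemma IsDenseNear.mem_convexHull (h : IsDenseNear x z ρ) (hρ : 0 < ρ) :
    z ∈ convexHull ℝ (Set.range x) := by
  by_contra hz
  obtain ⟨f, u, hfx, hfz⟩ := geometric_hahn_banach_closed_point (convex_convexHull ℝ _)
    ((Set.finite_range x).isClosed_convexHull ℝ) hz
  obtain ⟨b, rfl⟩ := (InnerProductSpace.toDual ℝ (Pt d)).surjective f
  simp only [InnerProductSpace.toDual_apply_apply] at hfx hfz
  have hlt (i) : inner ℝ b (x i) < inner ℝ b z :=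
    (hfx _ (subset_convexHull ℝ _ ⟨i, rfl⟩)).trans hfz
  have hb : 0 < ‖b‖ := norm_pos_iff.2 fun hb => by
    obtain ⟨i, -⟩ := h z (by simpa using hρ.le)
    simpa [hb] using hlt i
  obtain ⟨i, hi⟩ := h (z + (ρ / ‖b‖) • b) (by
    rw [dist_eq_norm, add_sub_cancel_left, norm_smul, Real.norm_of_nonneg (by positivity),
      div_mul_cancel₀ _ hb.ne'])
  have hcs := real_inner_le_norm b (z + (ρ / ‖b‖) • b - x i)
  rw [inner_sub_right, inner_add_right, inner_smul_right, real_inner_self_eq_norm_sq,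
    ← dist_eq_norm, dist_comm] at hcs
  have hcenter : ρ / ‖b‖ * ‖b‖ ^ 2 = ‖b‖ * ρ := by field_simp
  linarith [hlt i, mul_lt_mul_of_pos_left hi hb]

/-- A ball of radius `r > ρ` containing `z` contains a ball of radius `ρ` with center within
distance `ρ` of `z`. -/
lemma IsDenseNear.radius_le_of_empty_ball (h : IsDenseNear x z ρ) (hρ : 0 < ρ) {c : Pt d} {r : ℝ}
    (hz : dist z c ≤ r) (hempty : ∀ j, r ≤ dist (x j) c) : r ≤ ρ := by
  by_contra! hlt
  have hr : 0 < r := hρ.trans hlt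
  have hratio : ρ / r ≤ 1 := (div_le_one hr).2 hlt.le
  obtain ⟨i, hi⟩ := h (AffineMap.lineMap z c (ρ / r)) (by
    rw [dist_lineMap_left, Real.norm_of_nonneg (by positivity)]
    calc ρ / r * dist z c ≤ ρ / r * r := by gcongr
      _ = ρ := div_mul_cancel₀ _ hr.ne')
  have hcenter : dist (AffineMap.lineMap z c (ρ / r)) c ≤ r - ρ := by
    rw [dist_lineMap_right, Real.norm_of_nonneg (sub_nonneg.2 hratio)]
    calc (1 - ρ / r) * dist z c ≤ (1 - ρ / r) * r := by gcongr
      _ = r - ρ := by field_simp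
  linarith [hempty i, dist_triangle (x i) (AffineMap.lineMap z c (ρ / r)) c]

lemma IsDenseNear.dist_vertices_le (h : IsDenseNear x z ρ) (hρ : 0 < ρ)
    {s : Fin (d + 1) ↪o Fin n} (hs : IsDelaunayCell x s z) (k l : Fin (d + 1)) :
    dist (x (s k)) (x (s l)) ≤ 2 * ρ := by
  obtain ⟨c, r, hc, hempty⟩ := hs.exists_empty_circumsphere
  have hsub : convexHull ℝ (Set.range (x ∘ s)) ⊆ Metric.closedBall c r :=
    convexHull_min (Set.range_subset_iff.2 fun k => (hc k).le) (convex_closedBall c r)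
  have hr := h.radius_le_of_empty_ball hρ (hsub hs.mem_convexHull) hempty
  calc dist (x (s k)) (x (s l)) ≤ dist (x (s k)) c + dist (x (s l)) c := dist_triangle_right _ _ _
    _ ≤ 2 * ρ := by rw [hc, hc]; linarith

lemma exists_finset_isDenseNear (z : Pt d) (hρ : 0 < ρ) :
    ∃ F : Finset (Pt d), (∀ q ∈ F, dist q z ≤ ρ) ∧
      ∀ (n : ℕ) (x : Fin n → Pt d), (∀ q ∈ F, ∃ i, dist (x i) q < ρ / 2) → IsDenseNear x z ρ := by
  obtain ⟨F, hFz, hF, hcover⟩ := totallyBounded_iff_subset.1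
    (isCompact_closedBall z ρ).totallyBounded _ (Metric.dist_mem_uniformity (half_pos hρ))
  refine ⟨hF.toFinset, fun q hq => hFz (hF.mem_toFinset.1 hq), fun n x hx c hc => ?_⟩
  obtain ⟨q, hq, hcq⟩ := Set.mem_iUnion₂.1 (hcover (Metric.mem_closedBall.2 hc))
  obtain ⟨i, hi⟩ := hx q (hF.mem_toFinset.2 hq)
  have hcq : dist c q < ρ / 2 := hcq
  exact ⟨i, by linarith [dist_triangle_right (x i) c q]⟩

/-- The pairs of a configuration in general position and a point in the interior of one of its
Delaunay cells of diameter at most `δ`. -/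
def smallCellSet (d n : ℕ) (δ : ℝ) : Set ((Fin n → Pt d) × Pt d) :=
  {q | InGeneralPosition q.1 ∧ ∃ s : Fin (d + 1) ↪o Fin n, IsDelaunayCell q.1 s q.2 ∧
    ∀ k l, dist (q.1 (s k)) (q.1 (s l)) ≤ δ}

lemma measurableSet_inGeneralPosition : MeasurableSet {x : Fin n → Pt d | InGeneralPosition x} := by
  have hiff (x : Fin n → Pt d) : InGeneralPosition x ↔
      (∀ s : Fin (d + 1) ↪o Fin n, AffineIndependent ℝ (x ∘ s)) ∧
        ∀ (s : Fin (d + 1) ↪o Fin n) (j : Fin n), j ∉ Set.range s →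
          paraboloidLift (x ∘ s) (x j) ≠ ‖x j‖ ^ 2 :=
    ⟨fun h => ⟨h.1, h.2⟩, fun h => ⟨h.1, h.2⟩⟩
  simp only [hiff, measurableSet_setOfPred]
  refine (Measurable.forall fun s : Fin (d + 1) ↪o Fin n => measurableSet_setOfPred.1
    (measurableSet_affineIndependent_comp s)).and
    (Measurable.forall fun s => Measurable.forall fun j => measurable_const.imp ?_)
  exact measurableSet_setOfPred.1
    (measurableSet_eq_fun (measurable_paraboloidLift_comp s j) (by fun_prop)).compl

lemma measurableSet_smallCellSet (δ : ℝ) : MeasurableSet (smallCellSet d n δ) := by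
  refine (measurableSet_inGeneralPosition.preimage measurable_fst).inter
    (measurableSet_setOfPred.2 (Measurable.exists fun s => ?_))
  refine (measurableSet_setOfPred.1 (measurableSet_isDelaunayCell s)).and
    (Measurable.forall fun k => Measurable.forall fun l => measurableSet_setOfPred.1 ?_)
  exact measurableSet_le (by fun_prop) measurable_const

lemma IsDelaunay.mem_smallCellSet {T : Finset (Finset (Fin n))} (hT : IsDelaunay x T)
    (hx : InGeneralPosition x) (hz : IsOffFacets x z) (hρ : 0 < ρ) (h : IsDenseNear x z ρ) :
    (x, z) ∈ smallCellSet d n (2 * ρ) := by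
  obtain ⟨s, hs⟩ := hT.exists_isDelaunayCell hz (h.mem_convexHull hρ)
  exact ⟨hx, s, hs, h.dist_vertices_le hρ hs⟩

end SmallCells

section Regression

variable {E : Type*} [MeasurableSpace E] {ν : Measure (E × ℝ)} {g : E → ℝ}

/-- The deviation of the label of the example `q` from the value predicted by `g`. -/
def noise (g : E → ℝ) (q : E × ℝ) : ℝ := q.2 - g q.1

/-- The conditional variance of a label in `{0, 1}` with conditional mean `g`. -/
def bernoulliVar (g : E → ℝ) (z : E) : ℝ := g z * (1 - g z)

/-- `g` is the regression function of the law `ν` of an example with label in `{0, 1}`: the noise is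
orthogonal to the bounded functions of the point. -/
structure IsRegression (ν : Measure (E × ℝ)) (g : E → ℝ) : Prop where
  measurable : Measurable g
  mem_Icc : ∀ z, g z ∈ Set.Icc (0 : ℝ) 1
  binary : ∀ᵐ q ∂ν, q.2 = 0 ∨ q.2 = 1
  integral_mul_noise_eq_zero : ∀ (ψ : E → ℝ) (B : ℝ), Measurable ψ → (∀ z, |ψ z| ≤ B) →
    ∫ q, ψ q.1 * noise g q ∂ν = 0

/-- The points of a family of examples. -/
def design (D : Fin n → E × ℝ) : Fin n → E := fun i => (D i).1

/-- The labels of a family of examples. -/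
def labels (D : Fin n → E × ℝ) : Fin n → ℝ := fun i => (D i).2

@[fun_prop]
lemma measurable_design : Measurable (design : (Fin n → E × ℝ) → Fin n → E) := by
  unfold design
  fun_prop

@[fun_prop]
lemma measurable_labels : Measurable (labels : (Fin n → E × ℝ) → Fin n → ℝ) := by
  unfold labels
  fun_prop

lemma abs_sub_le_one_of_mem_Icc {a b : ℝ} (ha : a ∈ Set.Icc (0 : ℝ) 1)
    (hb : b ∈ Set.Icc (0 : ℝ) 1) : |a - b| ≤ 1 :=
  abs_le.2 ⟨by linarith [ha.1, hb.2], by linarith [ha.2, hb.1]⟩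

namespace IsRegression

lemma bernoulliVar_mem_Icc (h : IsRegression ν g) (z : E) : bernoulliVar g z ∈ Set.Icc (0 : ℝ) 1 :=
  have hg := h.mem_Icc z
  ⟨mul_nonneg hg.1 (sub_nonneg.2 hg.2),
    mul_le_one₀ hg.2 (sub_nonneg.2 hg.2) (sub_le_self 1 hg.1)⟩

lemma abs_one_sub_two_mul_le_one (h : IsRegression ν g) (z : E) : |1 - 2 * g z| ≤ 1 :=
  abs_le.2 ⟨by linarith [(h.mem_Icc z).2], by linarith [(h.mem_Icc z).1]⟩

lemma measurable_bernoulliVar (h : IsRegression ν g) : Measurable (bernoulliVar g) :=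
  h.measurable.mul (h.measurable.const_sub 1)

lemma integrable_bernoulliVar (h : IsRegression ν g) (μ : Measure E) [IsFiniteMeasure μ] :
    Integrable (bernoulliVar g) μ :=
  Integrable.of_mem_Icc 0 1 h.measurable_bernoulliVar.aemeasurable
    (Eventually.of_forall h.bernoulliVar_mem_Icc)

lemma bernoulliVar_le_bernoulliVar_add (h : IsRegression ν g) (u z : E) :
    bernoulliVar g u ≤ bernoulliVar g z + |g u - g z| := by
  have hfactor : bernoulliVar g u - bernoulliVar g z = (g u - g z) * ((1 - g u) - g z) := by
    unfold bernoulliVar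
    ring
  have hle : |(1 - g u) - g z| ≤ 1 := abs_sub_le_one_of_mem_Icc
    ⟨sub_nonneg.2 (h.mem_Icc u).2, sub_le_self 1 (h.mem_Icc u).1⟩ (h.mem_Icc z)
  rw [← sub_le_iff_le_add', hfactor]
  calc (g u - g z) * ((1 - g u) - g z) ≤ |g u - g z| * |(1 - g u) - g z| :=
        (le_abs_self _).trans (abs_mul _ _).le
    _ ≤ |g u - g z| := mul_le_of_le_one_right (abs_nonneg _) hle

lemma measurable_noise (h : IsRegression ν g) : Measurable (noise g) :=
  measurable_snd.sub (h.measurable.comp measurable_fst)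

lemma ae_label_mem_Icc (h : IsRegression ν g) : ∀ᵐ q ∂ν, q.2 ∈ Set.Icc (0 : ℝ) 1 := by
  filter_upwards [h.binary] with q hq
  rcases hq with hq | hq <;> simp [hq]

lemma ae_abs_noise_le_one (h : IsRegression ν g) : ∀ᵐ q ∂ν, |noise g q| ≤ 1 := by
  filter_upwards [h.ae_label_mem_Icc] with q hq using abs_sub_le_one_of_mem_Icc hq (h.mem_Icc _)

lemma ae_noise_sq (h : IsRegression ν g) :
    ∀ᵐ q ∂ν, noise g q * noise g q = (1 - 2 * g q.1) * noise g q + bernoulliVar g q.1 := by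
  filter_upwards [h.binary] with q hq
  rcases hq with hq | hq <;> rw [noise, bernoulliVar, hq] <;> ring

variable [IsProbabilityMeasure ν]

lemma integral_mul_removeNth_mul_noise (h : IsRegression ν g) (i : Fin (n + 1))
    {φ : (Fin (n + 1) → E) → ℝ} (hφ : Measurable φ) {B : ℝ} (hB : ∀ x, |φ x| ≤ B)
    (ζ : (Fin n → E × ℝ) → ℝ)
    (hint : Integrable (fun D => φ (design D) * ζ (i.removeNth D) * noise g (D i))
      (Measure.pi fun _ => ν)) :
    ∫ D, φ (design D) * ζ (i.removeNth D) * noise g (D i) ∂(Measure.pi fun _ => ν) = 0 := by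
  have hmp := (measurePreserving_piFinSuccAbove (fun _ : Fin (n + 1) => ν) i).symm
  have hint' := (hmp.integrable_comp_emb (MeasurableEquiv.measurableEmbedding _)).2 hint
  rw [← hmp.integral_comp']
  refine (integral_prod_symm _ hint').trans
    (integral_eq_zero_of_ae (Eventually.of_forall fun r => ?_))
  have hdesign (a : E × ℝ) :
      design (i.insertNth a r : Fin (n + 1) → E × ℝ) = i.insertNth a.1 (design r) :=
    funext fun j => by cases j using i.succAboveCases <;> simp [design]
  have hψ : Measurable fun u => φ (i.insertNth u (design r)) :=
    hφ.comp ((MeasurableEquiv.piFinSuccAbove (fun _ => E) i).symm.measurable.comp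
      (measurable_prodMk_right (y := design r)))
  change ∫ a, φ (design (i.insertNth a r : Fin (n + 1) → E × ℝ)) *
    ζ (i.removeNth (i.insertNth a r : Fin (n + 1) → E × ℝ)) *
      noise g ((i.insertNth a r : Fin (n + 1) → E × ℝ) i) ∂ν = 0
  simp only [hdesign, Fin.removeNth_insertNth, Fin.insertNth_apply_same, mul_right_comm _ (ζ r)]
  rw [integral_mul_const, h.integral_mul_noise_eq_zero _ B hψ fun u => hB _, zero_mul]

lemma ae_pi_abs_noise_le_one (h : IsRegression ν g) (i : Fin n) :
    ∀ᵐ D ∂(Measure.pi fun _ : Fin n => ν), |noise g (D i)| ≤ 1 :=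
  (Measure.quasiMeasurePreserving_eval (fun _ : Fin n => ν) i).ae h.ae_abs_noise_le_one

lemma integrable_design_mul_noise (h : IsRegression ν g) {φ : (Fin n → E) → ℝ} (hφ : Measurable φ)
    {B : ℝ} (hB : ∀ x, |φ x| ≤ B) (i : Fin n) :
    Integrable (fun D => φ (design D) * noise g (D i)) (Measure.pi fun _ => ν) := by
  have hnoise := h.measurable_noise
  refine Integrable.of_bound (by fun_prop) B ?_
  filter_upwards [h.ae_pi_abs_noise_le_one i] with D hD
  rw [Real.norm_eq_abs, abs_mul]
  exact (mul_le_of_le_one_right (abs_nonneg _) hD).trans (hB _)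

lemma integrable_design_mul_noise_mul_noise (h : IsRegression ν g) {φ : (Fin n → E) → ℝ}
    (hφ : Measurable φ) {B : ℝ} (hB : ∀ x, |φ x| ≤ B) (i j : Fin n) :
    Integrable (fun D => φ (design D) * noise g (D i) * noise g (D j))
      (Measure.pi fun _ => ν) := by
  have hnoise := h.measurable_noise
  exact (h.integrable_design_mul_noise hφ hB i).mul_bdd (c := 1)
    (hnoise.comp (measurable_pi_apply j)).aestronglyMeasurable (h.ae_pi_abs_noise_le_one j)

lemma integral_design_mul_noise (h : IsRegression ν g) {φ : (Fin n → E) → ℝ} (hφ : Measurable φ)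
    {B : ℝ} (hB : ∀ x, |φ x| ≤ B) (i : Fin n) :
    ∫ D, φ (design D) * noise g (D i) ∂(Measure.pi fun _ => ν) = 0 := by
  cases n with
  | zero => exact i.elim0
  | succ n =>
    simpa only [mul_one] using h.integral_mul_removeNth_mul_noise i hφ hB (fun _ => 1)
      (by simpa only [mul_one] using h.integrable_design_mul_noise hφ hB i)

lemma integral_design_mul_noise_mul_noise_of_ne (h : IsRegression ν g) {φ : (Fin n → E) → ℝ}
    (hφ : Measurable φ) {B : ℝ} (hB : ∀ x, |φ x| ≤ B) {i j : Fin n} (hij : i ≠ j) :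
    ∫ D, φ (design D) * noise g (D i) * noise g (D j) ∂(Measure.pi fun _ => ν) = 0 := by
  cases n with
  | zero => exact i.elim0
  | succ n =>
    obtain ⟨k, rfl⟩ := Fin.exists_succAbove_eq hij
    exact h.integral_mul_removeNth_mul_noise j hφ hB (fun r => noise g (r k))
      (h.integrable_design_mul_noise_mul_noise hφ hB _ j)

lemma integrable_design_mul_bernoulliVar (h : IsRegression ν g) {φ : (Fin n → E) → ℝ}
    (hφ : Measurable φ) {B : ℝ} (hB : ∀ x, |φ x| ≤ B) (i : Fin n) :
    Integrable (fun D => φ (design D) * bernoulliVar g (design D i)) (Measure.pi fun _ => ν) := by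
  have hv := h.measurable_bernoulliVar
  refine Integrable.of_bound (by fun_prop) B (Eventually.of_forall fun D => ?_)
  have hmem := h.bernoulliVar_mem_Icc (design D i)
  rw [Real.norm_eq_abs, abs_mul, abs_of_nonneg hmem.1]
  exact (mul_le_of_le_one_right (abs_nonneg _) hmem.2).trans (hB _)

lemma integral_design_mul_noise_mul_self (h : IsRegression ν g) {φ : (Fin n → E) → ℝ}
    (hφ : Measurable φ) {B : ℝ} (hB : ∀ x, |φ x| ≤ B) (i : Fin n) :
    ∫ D, φ (design D) * noise g (D i) * noise g (D i) ∂(Measure.pi fun _ => ν) =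
      ∫ D, φ (design D) * bernoulliVar g (design D i) ∂(Measure.pi fun _ => ν) := by
  have hg := h.measurable
  have hφg : Measurable fun x : Fin n → E => φ x * (1 - 2 * g (x i)) := by fun_prop
  have hφgB (x : Fin n → E) : |φ x * (1 - 2 * g (x i))| ≤ B := by
    rw [abs_mul]
    exact (mul_le_of_le_one_right (abs_nonneg _) (h.abs_one_sub_two_mul_le_one _)).trans (hB x)
  have hsq : ∀ᵐ D ∂(Measure.pi fun _ : Fin n => ν), φ (design D) * noise g (D i) * noise g (D i) =
      φ (design D) * (1 - 2 * g (design D i)) * noise g (D i) +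
        φ (design D) * bernoulliVar g (design D i) := by
    filter_upwards [(Measure.quasiMeasurePreserving_eval (fun _ : Fin n => ν) i).ae h.ae_noise_sq]
      with D hD
    rw [mul_assoc, hD, design]
    ring
  rw [integral_congr_ae hsq, integral_add (h.integrable_design_mul_noise hφg hφgB i)
    (h.integrable_design_mul_bernoulliVar hφ hB i),
    h.integral_design_mul_noise hφg hφgB i, zero_add]

variable {w : Fin n → (Fin n → E) → ℝ} {b : (Fin n → E) → ℝ} {B : ℝ}

lemma integrable_sum_sq_mul_bernoulliVar (h : IsRegression ν g) (hw : ∀ i, Measurable (w i))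
    (hwB : ∀ i x, |w i x| ≤ B) :
    Integrable (fun D => ∑ i, w i (design D) ^ 2 * bernoulliVar g (design D i))
      (Measure.pi fun _ => ν) :=
  integrable_finsetSum _ fun i _ =>
    h.integrable_design_mul_bernoulliVar ((hw i).pow_const 2) (B := B ^ 2)
      (fun x => abs_pow (w i x) 2 ▸ pow_le_pow_left₀ (abs_nonneg _) (hwB i x) 2) i

lemma integrable_sq_sum_noise (h : IsRegression ν g) (hw : ∀ i, Measurable (w i))
    (hwB : ∀ i x, |w i x| ≤ B) :
    Integrable (fun D => (∑ i, w i (design D) * noise g (D i)) ^ 2) (Measure.pi fun _ => ν) :=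
  (memLp_finsetSum _ fun i _ => (memLp_top_of_bound
    (h.integrable_design_mul_noise (hw i) (hwB i) i).aestronglyMeasurable B (by
      filter_upwards [h.ae_pi_abs_noise_le_one i] with D hD
      rw [Real.norm_eq_abs, abs_mul]
      exact (mul_le_of_le_one_right (abs_nonneg _) hD).trans (hwB i _))).mono_exponent
        le_top).integrable_sq

/-- Given the design, the noise of different examples is uncorrelated. -/
lemma integral_sq_sum_noise (h : IsRegression ν g) (hw : ∀ i, Measurable (w i))
    (hwB : ∀ i x, |w i x| ≤ B) :
    ∫ D, (∑ i, w i (design D) * noise g (D i)) ^ 2 ∂(Measure.pi fun _ => ν) =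
      ∫ D, ∑ i, w i (design D) ^ 2 * bernoulliVar g (design D i) ∂(Measure.pi fun _ => ν) := by
  have hww (i j) : Measurable fun x => w i x * w j x := (hw i).mul (hw j)
  have hwwB (i j x) : |w i x * w j x| ≤ B * B := abs_mul (w i x) (w j x) ▸
    mul_le_mul (hwB i x) (hwB j x) (abs_nonneg _) ((abs_nonneg _).trans (hwB i x))
  have hpair (i j) := h.integrable_design_mul_noise_mul_noise (hww i j) (hwwB i j) i j
  have hexpand (D : Fin n → E × ℝ) : (∑ i, w i (design D) * noise g (D i)) ^ 2 =
      ∑ i, ∑ j, w i (design D) * w j (design D) * noise g (D i) * noise g (D j) := by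
    rw [sq, Finset.sum_mul_sum]
    exact Finset.sum_congr rfl fun i _ => Finset.sum_congr rfl fun j _ => by ring
  simp only [hexpand, sq (w _ _)]
  rw [integral_finsetSum _ fun i _ => integrable_finsetSum _ fun j _ => hpair i j,
    integral_finsetSum _ fun i _ => h.integrable_design_mul_bernoulliVar (hww i i) (hwwB i i) i]
  refine Finset.sum_congr rfl fun i _ => ?_
  rw [integral_finsetSum _ fun j _ => hpair i j, Finset.sum_eq_single i]
  · exact h.integral_design_mul_noise_mul_self (hww i i) (hwwB i i) i
  · exact fun j _ hji =>
      h.integral_design_mul_noise_mul_noise_of_ne (hww i j) (hwwB i j) hji.symm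
  · exact fun hi => absurd (Finset.mem_univ i) hi

lemma integral_sq_sum_noise_add (h : IsRegression ν g) (hw : ∀ i, Measurable (w i))
    (hb : Measurable b) (hwB : ∀ i x, |w i x| ≤ B) (hbB : ∀ x, |b x| ≤ B) :
    ∫ D, (∑ i, w i (design D) * noise g (D i) + b (design D)) ^ 2 ∂(Measure.pi fun _ => ν) =
      ∫ D, (∑ i, w i (design D) ^ 2 * bernoulliVar g (design D i) + b (design D) ^ 2)
        ∂(Measure.pi fun _ => ν) := by
  have hbw (i) : Measurable fun x => 2 * b x * w i x := (hb.const_mul 2).mul (hw i)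
  have hbwB (i x) : |2 * b x * w i x| ≤ 2 * B * B := by
    rw [abs_mul, abs_mul, abs_two]
    have hB : 0 ≤ B := (abs_nonneg _).trans (hbB x)
    exact mul_le_mul (by linarith [hbB x]) (hwB i x) (abs_nonneg _) (by positivity)
  have hcross (i) := h.integrable_design_mul_noise (hbw i) (hbwB i) i
  have hbsq : Integrable (fun D : Fin n → E × ℝ => b (design D) ^ 2) (Measure.pi fun _ => ν) :=
    Integrable.of_bound ((hb.comp measurable_design).pow_const 2).aestronglyMeasurable (B ^ 2)
      (Eventually.of_forall fun D => by
        rw [norm_pow]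
        exact pow_le_pow_left₀ (norm_nonneg _) (hbB _) 2)
  have hexpand (D : Fin n → E × ℝ) : (∑ i, w i (design D) * noise g (D i) + b (design D)) ^ 2 =
      (∑ i, w i (design D) * noise g (D i)) ^ 2 + b (design D) ^ 2 +
        ∑ i, 2 * b (design D) * w i (design D) * noise g (D i) := by
    rw [add_sq, add_right_comm, mul_right_comm, Finset.mul_sum]
    simp only [mul_assoc]
  simp only [hexpand]
  rw [integral_add ((h.integrable_sq_sum_noise hw hwB).fun_add hbsq)
      (integrable_finsetSum _ fun i _ => hcross i),
    integral_add (h.integrable_sq_sum_noise hw hwB) hbsq,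
    integral_add (h.integrable_sum_sq_mul_bernoulliVar hw hwB) hbsq,
    h.integral_sq_sum_noise hw hwB, integral_finsetSum _ fun i _ => hcross i,
    Finset.sum_eq_zero fun i _ => h.integral_design_mul_noise (hbw i) (hbwB i) i, add_zero]

lemma setIntegral_sq_sum_noise_add (h : IsRegression ν g) {S : Set (Fin n → E)}
    (hS : MeasurableSet S) (hw : ∀ i, Measurable (w i)) (hb : Measurable b) (hB : 0 ≤ B)
    (hwB : ∀ i, ∀ x ∈ S, |w i x| ≤ B) (hbB : ∀ x ∈ S, |b x| ≤ B) :
    ∫ D in design ⁻¹' S, (∑ i, w i (design D) * noise g (D i) + b (design D)) ^ 2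
        ∂(Measure.pi fun _ => ν) =
      ∫ D in design ⁻¹' S, (∑ i, w i (design D) ^ 2 * bernoulliVar g (design D i) +
        b (design D) ^ 2) ∂(Measure.pi fun _ => ν) := by
  have hbound {u : (Fin n → E) → ℝ} (hu : ∀ x ∈ S, |u x| ≤ B) (x) : |S.indicator u x| ≤ B := by
    by_cases hx : x ∈ S
    · simpa only [Set.indicator_of_mem hx] using hu x hx
    · simpa only [Set.indicator_of_notMem hx, abs_zero] using hB
  have hglobal := h.integral_sq_sum_noise_add (fun i => (hw i).indicator hS) (hb.indicator hS)
    (fun i => hbound (hwB i)) (hbound hbB)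
  rw [← integral_indicator (hS.preimage measurable_design),
    ← integral_indicator (hS.preimage measurable_design)]
  convert hglobal using 3 with D D <;>
  · by_cases hD : design D ∈ S <;> simp [hD]

end IsRegression

end Regression

section ConditionalError

lemma setIntegral_prod_eq_integral_setIntegral {α β : Type*} [MeasurableSpace α]
    [MeasurableSpace β] {μ : Measure α} {ν : Measure β} [SFinite μ] [SFinite ν]
    {G : Set (α × β)} (hG : MeasurableSet G) {f : α × β → ℝ} (hf : IntegrableOn f G (μ.prod ν)) :
    ∫ q in G, f q ∂(μ.prod ν) = ∫ a, ∫ b in Prod.mk a ⁻¹' G, f (a, b) ∂ν ∂μ := by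
  rw [← integral_indicator hG, integral_prod _ ((integrable_indicator_iff hG).2 hf)]
  exact integral_congr_ae (Eventually.of_forall fun a =>
    integral_indicator (hG.preimage measurable_prodMk_left))

lemma setIntegral_prod_eq_integral_setIntegral_symm {α β : Type*} [MeasurableSpace α]
    [MeasurableSpace β] {μ : Measure α} {ν : Measure β} [SFinite μ] [SFinite ν]
    {G : Set (α × β)} (hG : MeasurableSet G) {f : α × β → ℝ} (hf : IntegrableOn f G (μ.prod ν)) :
    ∫ q in G, f q ∂(μ.prod ν) = ∫ b, ∫ a in (fun a => (a, b)) ⁻¹' G, f (a, b) ∂μ ∂ν := by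
  rw [← integral_indicator hG, integral_prod_symm _ ((integrable_indicator_iff hG).2 hf)]
  exact integral_congr_ae (Eventually.of_forall fun b =>
    integral_indicator (hG.preimage measurable_prodMk_right))

/-- The error at `z` of the simplicial interpolation of the values of `g` at the design. -/
def interpBias (g : Pt d → ℝ) (x : Fin n → Pt d) (z : Pt d) : ℝ :=
  ∑ i, interpWeight x z i * g (x i) - g z

/-- The mean squared error at `z` given the design `x`: variance plus squared bias. -/
def condMSE (g : Pt d → ℝ) (x : Fin n → Pt d) (z : Pt d) : ℝ :=
  ∑ i, interpWeight x z i ^ 2 * bernoulliVar g (x i) + interpBias g x z ^ 2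

variable {C : Set (Pt d)} {x : Fin n → Pt d} {s : Fin (d + 1) ↪o Fin n} {z : Pt d} {δ ε : ℝ}

lemma dist_le_of_mem_convexHull_range {ι E : Type*} [SeminormedAddCommGroup E] [NormedSpace ℝ E]
    {p : ι → E} (hp : ∀ k l, dist (p k) (p l) ≤ δ) {z : E} (hz : z ∈ convexHull ℝ (Set.range p))
    (k : ι) : dist (p k) z ≤ δ :=
  dist_comm z (p k) ▸ convexHull_min (Set.range_subset_iff.2 fun l => hp l k)
    (convex_closedBall (p k) δ) hz

lemma IsDelaunayCell.mem_of_convex (hs : IsDelaunayCell x s z) (hC : Convex ℝ C)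
    (hxC : ∀ i, x i ∈ C) : z ∈ C :=
  convexHull_min (Set.range_subset_iff.2 fun k => hxC (s k)) hC hs.mem_convexHull

namespace InGeneralPosition

lemma interpWeight_mem_Icc (hx : InGeneralPosition x) (z : Pt d) (i : Fin n) :
    interpWeight x z i ∈ Set.Icc (0 : ℝ) 1 := by
  refine ⟨hx.interpWeight_nonneg i, ?_⟩
  by_cases hcell : ∃ s, IsDelaunayCell x s z
  · obtain ⟨s, hs⟩ := hcell
    rw [← hx.sum_interpWeight hs]
    exact Finset.single_le_sum (fun i _ => hx.interpWeight_nonneg i) (Finset.mem_univ i)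
  · rw [interpWeight_eq_zero (not_exists.1 hcell)]
    exact zero_le_one

lemma abs_interpBias_le (hx : InGeneralPosition x) (hs : IsDelaunayCell x s z) {g : Pt d → ℝ}
    (hg : ∀ k, |g (x (s k)) - g z| ≤ ε) : |interpBias g x z| ≤ ε := by
  rw [interpBias, hx.sum_eq_sum_vertices hs (fun w i => w * g (x i)) fun i => zero_mul _,
    ← Real.dist_eq, ← Metric.mem_closedBall]
  exact (convex_closedBall (g z) ε).sum_mem (fun k _ => (hs.bary_pos k).le)
    (sum_bary hs.affineIndependent z) fun k _ => Metric.mem_closedBall.2 (hg k)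

lemma exists_finset_smallCellSet_eq (hx : InGeneralPosition x) (δ : ℝ) :
    ∃ S : Finset (Fin (d + 1) ↪o Fin n), (∀ s ∈ S, ∀ k l, dist (x (s k)) (x (s l)) ≤ δ) ∧
      (∀ s ∈ S, ∀ z ∈ openSimplex (x ∘ s), IsDelaunayCell x s z) ∧
      Prod.mk x ⁻¹' smallCellSet d n δ = ⋃ s ∈ S, openSimplex (x ∘ s) := by
  classical
  refine ⟨Finset.univ.filter fun s => (∀ j, paraboloidLift (x ∘ s) (x j) ≤ ‖x j‖ ^ 2) ∧
    ∀ k l, dist (x (s k)) (x (s l)) ≤ δ, fun s hs => (Finset.mem_filter.1 hs).2.2,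
    fun s hs z hz => ⟨hx.affineIndependent s, hz, (Finset.mem_filter.1 hs).2.1⟩, ?_⟩
  ext z
  simp only [Set.mem_iUnion, Finset.mem_filter, Finset.mem_univ, true_and, exists_prop]
  constructor
  · rintro ⟨-, s, hs, hδ⟩
    exact ⟨s, ⟨hs.paraboloidLift_le, hδ⟩, hs.bary_pos⟩
  · rintro ⟨s, ⟨hlift, hδ⟩, hz⟩
    exact ⟨hx, s, ⟨hx.affineIndependent s, hz, hlift⟩, hδ⟩

lemma setIntegral_sum_interpWeight_sq_mul_le (hx : InGeneralPosition x) (hC : Convex ℝ C)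
    (hxC : ∀ i, x i ∈ C) {v : Pt d → ℝ} (hv : LocallyIntegrable v)
    (hvε : ∀ u ∈ C, ∀ z ∈ C, dist u z ≤ δ → v u ≤ v z + ε) :
    ∫ z in Prod.mk x ⁻¹' smallCellSet d n δ, ∑ i, interpWeight x z i ^ 2 * v (x i) ≤
      2 / (d + 2) * ∫ z in Prod.mk x ⁻¹' smallCellSet d n δ, (v z + ε) := by
  obtain ⟨S, hSδ, hcell, hS⟩ := hx.exists_finset_smallCellSet_eq δ
  have hmeas (s : Fin (d + 1) ↪o Fin n) : MeasurableSet (openSimplex (x ∘ s)) :=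
    measurableSet_openSimplex (hx.affineIndependent s)
  have hdisj : (S : Set (Fin (d + 1) ↪o Fin n)).PairwiseDisjoint fun s => openSimplex (x ∘ s) :=
    fun s hs t ht hst => Set.disjoint_left.2 fun z hzs hzt =>
      hst (hx.isDelaunayCell_unique (hcell s hs z hzs) (hcell t ht z hzt))
  have hint {f : Pt d → ℝ} (hf : LocallyIntegrable f) (s : Fin (d + 1) ↪o Fin n) :
      IntegrableOn f (openSimplex (x ∘ s)) :=
    (hf.integrableOn_isCompact ((Set.finite_range (x ∘ s)).isCompact_convexHull ℝ)).mono_set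
      (openSimplex_subset_convexHull (hx.affineIndependent s))
  have hweights (s) (hs : s ∈ S) : Set.EqOn (fun z => ∑ i, interpWeight x z i ^ 2 * v (x i))
      (fun z => ∑ k, bary (x ∘ s) z k ^ 2 * v (x (s k))) (openSimplex (x ∘ s)) := fun z hz =>
    hx.sum_eq_sum_vertices (hcell s hs z hz) (fun w i => w ^ 2 * v (x i)) (by simp)
  have hbary (s : Fin (d + 1) ↪o Fin n) :
      Continuous fun z => ∑ k, bary (x ∘ s) z k ^ 2 * v (x (s k)) :=
    continuous_finsetSum _ fun k _ =>
      ((continuous_bary (hx.affineIndependent s) k).pow 2).mul_const _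
  have hvε' : LocallyIntegrable fun z => v z + ε := hv.add (locallyIntegrable_const ε)
  rw [hS, integral_biUnion_finset _ (fun s _ => hmeas s) hdisj fun s hs =>
      (hint (hbary s).locallyIntegrable s).congr_fun (hweights s hs).symm (hmeas s),
    integral_biUnion_finset _ (fun s _ => hmeas s) hdisj fun s _ => hint hvε' s, Finset.mul_sum]
  refine Finset.sum_le_sum fun s hs => ?_
  rw [setIntegral_congr_fun (hmeas s) (hweights s hs)]
  refine integral_openSimplex_sum_bary_sq_mul_le (hx.affineIndependent s) (hint hv s)
    fun k z hz => hvε _ (hxC _) _ ((hcell s hs z hz).mem_of_convex hC hxC) ?_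
  exact dist_le_of_mem_convexHull_range (hSδ s hs) (hcell s hs z hz).mem_convexHull k

end InGeneralPosition

end ConditionalError

section UniformLaw

variable {α : Type*} [MeasurableSpace α] {μ : Measure α} {C : Set α}

lemma setIntegral_cond_eq {S : Set α} (hS : MeasurableSet S) (hSC : S ⊆ C) (f : α → ℝ) :
    ∫ z in S, f z ∂(cond μ C) = (μ C)⁻¹.toReal * ∫ z in S, f z ∂μ := by
  rw [ProbabilityTheory.cond, Measure.restrict_smul, Measure.restrict_restrict hS,
    Set.inter_eq_left.2 hSC, integral_smul_measure, smul_eq_mul]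

lemma pi_cond_absolutelyContinuous [SigmaFinite μ] (hC : MeasurableSet C) (n : ℕ) :
    (Measure.pi fun _ : Fin n => cond μ C) ≪ Measure.pi fun _ : Fin n => μ := by
  have hpi : (Measure.pi fun _ : Fin n => cond μ C) =
      ((μ C)⁻¹ ^ n) • (Measure.pi fun _ => μ).restrict (Set.univ.pi fun _ => C) :=
    Measure.pi_eq fun s hs => by
      rw [Measure.smul_apply, Measure.restrict_apply (MeasurableSet.univ_pi hs),
        ← Set.pi_inter_distrib, Measure.pi_pi, smul_eq_mul]
      simp only [cond_apply hC, Finset.prod_mul_distrib, Finset.prod_const, Finset.card_univ,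
        Fintype.card_fin, Set.inter_comm C]
  rw [hpi]
  exact Measure.restrict_le_self.absolutelyContinuous.smul_left _

end UniformLaw

section MeanSquaredError

variable {C : Set (Pt d)} {ν : Measure (Pt d × ℝ)} {g : Pt d → ℝ} {x : Fin n → Pt d} {z : Pt d}
  {δ ε : ℝ}

lemma map_design_pi {E : Type*} [MeasurableSpace E] (ν : Measure (E × ℝ))
    [IsProbabilityMeasure ν] :
    (Measure.pi fun _ : Fin n => ν).map design = Measure.pi fun _ => ν.map Prod.fst :=
  have (_ : Fin n) : SigmaFinite (ν.map Prod.fst) :=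
    have := Measure.isProbabilityMeasure_map (μ := ν) measurable_fst.aemeasurable
    inferInstance
  Measure.pi_map_pi (μ := fun _ : Fin n => ν) fun _ => measurable_fst.aemeasurable

lemma measurable_cellInterp_design_labels : Measurable fun q : (Fin n → Pt d × ℝ) × Pt d =>
    cellInterp (design q.1) (labels q.1) q.2 :=
  measurable_cellInterp.comp (f := fun q : (Fin n → Pt d × ℝ) × Pt d =>
    ((design q.1, labels q.1), q.2)) (by fun_prop)

lemma ae_design_mem (hC : MeasurableSet C) [IsProbabilityMeasure ν]
    (hν : ν.map Prod.fst = cond volume C) :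
    ∀ᵐ D ∂(Measure.pi fun _ : Fin n => ν), ∀ i, design D i ∈ C :=
  ae_all_iff.2 fun i => (Measure.quasiMeasurePreserving_eval (fun _ : Fin n => ν) i).ae
    (ae_of_ae_map measurable_fst.aemeasurable (hν ▸ ae_cond_mem hC))

lemma ae_inGeneralPosition_design (hd : 1 ≤ d) (hC : MeasurableSet C) [IsProbabilityMeasure ν]
    (hν : ν.map Prod.fst = cond volume C) (n : ℕ) :
    ∀ᵐ D ∂(Measure.pi fun _ : Fin n => ν), InGeneralPosition (design D) := by
  refine ae_of_ae_map measurable_design.aemeasurable ?_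
  rw [map_design_pi, hν]
  exact (pi_cond_absolutelyContinuous hC n).ae_le (ae_inGeneralPosition hd n)

lemma InGeneralPosition.integrable_sum_interpWeight_sq_mul_bernoulliVar (hx : InGeneralPosition x)
    (g : Pt d → ℝ) (μ : Measure (Pt d)) [IsFiniteMeasure μ] :
    Integrable (fun z => ∑ i, interpWeight x z i ^ 2 * bernoulliVar g (x i)) μ := by
  refine integrable_finsetSum _ fun i _ =>
    (Integrable.of_mem_Icc 0 1 ?_ (Eventually.of_forall fun z => ?_)).mul_const _
  · exact (((measurable_interpWeight i).comp measurable_prodMk_left).pow_const 2).aemeasurable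
  · have hw := hx.interpWeight_mem_Icc z i
    exact ⟨sq_nonneg _, pow_le_one₀ hw.1 hw.2⟩

namespace IsRegression

lemma locallyIntegrable_bernoulliVar (h : IsRegression ν g) : LocallyIntegrable (bernoulliVar g) :=
  locallyIntegrable_iff.2 fun K hK =>
    have := isFiniteMeasure_restrict (μ := volume).2 hK.measure_lt_top.ne
    h.integrable_bernoulliVar (volume.restrict K)

lemma measurable_interpBias (h : IsRegression ν g) :
    Measurable fun q : (Fin n → Pt d) × Pt d => interpBias g q.1 q.2 := by
  have hg := h.measurable
  have hweight (i) := measurable_interpWeight (d := d) (n := n) i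
  unfold interpBias
  fun_prop

lemma measurable_condMSE (h : IsRegression ν g) :
    Measurable fun q : (Fin n → Pt d) × Pt d => condMSE g q.1 q.2 := by
  have hv := h.measurable_bernoulliVar
  have hweight (i) := measurable_interpWeight (d := d) (n := n) i
  have hbias := h.measurable_interpBias (n := n)
  unfold condMSE
  fun_prop

lemma abs_interpBias_le_one (h : IsRegression ν g) (hxz : (x, z) ∈ smallCellSet d n δ) :
    |interpBias g x z| ≤ 1 :=
  hxz.1.abs_interpBias_le hxz.2.choose_spec.1 fun _ =>
    abs_sub_le_one_of_mem_Icc (h.mem_Icc _) (h.mem_Icc _)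

lemma condMSE_mem_Icc (h : IsRegression ν g) (hxz : (x, z) ∈ smallCellSet d n δ) :
    condMSE g x z ∈ Set.Icc (0 : ℝ) 2 := by
  obtain ⟨hx, s, hs, -⟩ := id hxz
  have hw := hx.interpWeight_mem_Icc z
  have hv (i) := h.bernoulliVar_mem_Icc (x i)
  constructor
  · exact add_nonneg (Finset.sum_nonneg fun i _ => mul_nonneg (sq_nonneg _) (hv i).1) (sq_nonneg _)
  calc condMSE g x z ≤ ∑ i, interpWeight x z i + 1 := by
        refine add_le_add (Finset.sum_le_sum fun i _ => ?_)
          ((sq_le_one_iff_abs_le_one _).2 (h.abs_interpBias_le_one hxz))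
        exact (mul_le_of_le_one_right (sq_nonneg _) (hv i).2).trans
          (pow_le_of_le_one (hw i).1 (hw i).2 two_ne_zero)
    _ = 2 := by rw [hx.sum_interpWeight hs]; norm_num

lemma setIntegral_sum_interpWeight_sq_mul_bernoulliVar_le (h : IsRegression ν g)
    [IsProbabilityMeasure (cond volume C)] (hC : Convex ℝ C) (hx : InGeneralPosition x)
    (hxC : ∀ i, x i ∈ C) (hε : 0 ≤ ε)
    (hδ : ∀ u ∈ C, ∀ z ∈ C, dist u z ≤ δ → |g u - g z| ≤ ε) :
    ∫ z in Prod.mk x ⁻¹' smallCellSet d n δ,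
        ∑ i, interpWeight x z i ^ 2 * bernoulliVar g (x i) ∂(cond volume C) ≤
      2 / (d + 2) * (∫ z, bernoulliVar g z ∂(cond volume C) + ε) := by
  set G := Prod.mk x ⁻¹' smallCellSet d n δ
  have hG : MeasurableSet G := (measurableSet_smallCellSet δ).preimage measurable_prodMk_left
  have hGC : G ⊆ C := fun z ⟨_, _, hs, _⟩ => hs.mem_of_convex hC hxC
  have hvar : Integrable (fun z => bernoulliVar g z + ε) (cond volume C) :=
    (h.integrable_bernoulliVar _).add (integrable_const ε)
  calc ∫ z in G, ∑ i, interpWeight x z i ^ 2 * bernoulliVar g (x i) ∂(cond volume C)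
      = (volume C)⁻¹.toReal * ∫ z in G, ∑ i, interpWeight x z i ^ 2 * bernoulliVar g (x i) :=
        setIntegral_cond_eq hG hGC _
    _ ≤ (volume C)⁻¹.toReal * (2 / (d + 2) * ∫ z in G, (bernoulliVar g z + ε)) := by
        gcongr
        exact hx.setIntegral_sum_interpWeight_sq_mul_le hC hxC h.locallyIntegrable_bernoulliVar
          fun u hu z hz huz => (h.bernoulliVar_le_bernoulliVar_add u z).trans
            (add_le_add_right (hδ u hu z hz huz) _)
    _ = 2 / (d + 2) * ∫ z in G, (bernoulliVar g z + ε) ∂(cond volume C) := by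
        rw [setIntegral_cond_eq hG hGC, mul_left_comm]
    _ ≤ 2 / (d + 2) * ∫ z, (bernoulliVar g z + ε) ∂(cond volume C) :=
        mul_le_mul_of_nonneg_left (setIntegral_le_integral hvar (Eventually.of_forall fun z =>
          add_nonneg (h.bernoulliVar_mem_Icc z).1 hε)) (by positivity)
    _ = 2 / (d + 2) * (∫ z, bernoulliVar g z ∂(cond volume C) + ε) := by
        rw [integral_add (h.integrable_bernoulliVar _) (integrable_const _), integral_const,
          probReal_univ, one_smul]

lemma setIntegral_condMSE_le (h : IsRegression ν g) [IsProbabilityMeasure (cond volume C)]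
    (hC : Convex ℝ C) (hx : InGeneralPosition x) (hxC : ∀ i, x i ∈ C) (hε : 0 ≤ ε)
    (hδ : ∀ u ∈ C, ∀ z ∈ C, dist u z ≤ δ → |g u - g z| ≤ ε) :
    ∫ z in Prod.mk x ⁻¹' smallCellSet d n δ, condMSE g x z ∂(cond volume C) ≤
      2 / (d + 2) * (∫ z, bernoulliVar g z ∂(cond volume C) + ε) + ε ^ 2 := by
  set G := Prod.mk x ⁻¹' smallCellSet d n δ
  have hG : MeasurableSet G := (measurableSet_smallCellSet δ).preimage measurable_prodMk_left
  have hvariance := (hx.integrable_sum_interpWeight_sq_mul_bernoulliVar g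
    (cond volume C)).integrableOn (s := G)
  have hcondMSE : IntegrableOn (condMSE g x) G (cond volume C) :=
    Integrable.of_mem_Icc 0 2 (h.measurable_condMSE.comp measurable_prodMk_left).aemeasurable
      (ae_restrict_of_forall_mem hG fun z hz => h.condMSE_mem_Icc hz)
  have hbias (z) (hz : z ∈ G) : interpBias g x z ^ 2 ≤ ε ^ 2 := by
    obtain ⟨-, s, hs, hsδ⟩ := hz
    rw [← sq_abs]
    exact pow_le_pow_left₀ (abs_nonneg _) (hx.abs_interpBias_le hs fun k =>
      hδ _ (hxC _) _ (hs.mem_of_convex hC hxC)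
        (dist_le_of_mem_convexHull_range hsδ hs.mem_convexHull k)) 2
  calc ∫ z in G, condMSE g x z ∂(cond volume C)
      ≤ ∫ z in G, (∑ i, interpWeight x z i ^ 2 * bernoulliVar g (x i) + ε ^ 2)
          ∂(cond volume C) :=
        setIntegral_mono_on hcondMSE (hvariance.add (integrable_const _)) hG
          fun z hz => add_le_add_right (hbias z hz) _
    _ = (∫ z in G, ∑ i, interpWeight x z i ^ 2 * bernoulliVar g (x i) ∂(cond volume C)) +
          (cond volume C).real G * ε ^ 2 := by
        rw [integral_add hvariance (integrable_const _), setIntegral_const, smul_eq_mul]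
    _ ≤ 2 / (d + 2) * (∫ z, bernoulliVar g z ∂(cond volume C) + ε) + ε ^ 2 :=
        add_le_add (h.setIntegral_sum_interpWeight_sq_mul_bernoulliVar_le hC hx hxC hε hδ)
          (mul_le_of_le_one_left (sq_nonneg ε) measureReal_le_one)

variable [IsProbabilityMeasure ν]

lemma setIntegral_sq_cellInterp_sub (h : IsRegression ν g) (δ : ℝ) (z : Pt d) :
    ∫ D in design ⁻¹' ((fun x => (x, z)) ⁻¹' smallCellSet d n δ),
        (cellInterp (design D) (labels D) z - g z) ^ 2 ∂(Measure.pi fun _ => ν) =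
      ∫ D in design ⁻¹' ((fun x => (x, z)) ⁻¹' smallCellSet d n δ), condMSE g (design D) z
        ∂(Measure.pi fun _ => ν) := by
  have hS : MeasurableSet ((fun x => (x, z)) ⁻¹' smallCellSet d n δ) :=
    (measurableSet_smallCellSet δ).preimage measurable_prodMk_right
  have hsplit : Set.EqOn (fun D => (cellInterp (design D) (labels D) z - g z) ^ 2)
      (fun D => (∑ i, interpWeight (design D) z i * noise g (D i) +
        interpBias g (design D) z) ^ 2)
      (design ⁻¹' ((fun x => (x, z)) ⁻¹' smallCellSet d n δ)) := by
    rintro D ⟨hx, s, hs, -⟩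
    simp only [hx.cellInterp_eq hs, interpBias, noise, labels, design, mul_sub,
      Finset.sum_sub_distrib, sub_add_sub_cancel]
  have hw (i : Fin n) (x) (hx : x ∈ (fun x => (x, z)) ⁻¹' smallCellSet d n δ) :
      |interpWeight x z i| ≤ 1 := by
    have hmem := (Set.mem_preimage.1 hx).1.interpWeight_mem_Icc z i
    exact (abs_of_nonneg hmem.1).trans_le hmem.2
  rw [setIntegral_congr_fun (hS.preimage measurable_design) hsplit]
  exact h.setIntegral_sq_sum_noise_add hS
    (fun i => (measurable_interpWeight i).comp measurable_prodMk_right)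
    (h.measurable_interpBias.comp measurable_prodMk_right) zero_le_one hw
    fun x hx => h.abs_interpBias_le_one hx

lemma ae_pi_label_mem_Icc (h : IsRegression ν g) :
    ∀ᵐ D ∂(Measure.pi fun _ : Fin n => ν), ∀ i, labels D i ∈ Set.Icc (0 : ℝ) 1 :=
  ae_all_iff.2 fun i =>
    (Measure.quasiMeasurePreserving_eval (fun _ : Fin n => ν) i).ae h.ae_label_mem_Icc

lemma ae_sq_cellInterp_sub_mem_Icc (h : IsRegression ν g) (hd : 1 ≤ d) (hC : MeasurableSet C)
    (hν : ν.map Prod.fst = cond volume C) :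
    ∀ᵐ D ∂(Measure.pi fun _ : Fin n => ν), ∀ z,
      (cellInterp (design D) (labels D) z - g z) ^ 2 ∈ Set.Icc (0 : ℝ) 1 := by
  filter_upwards [ae_inGeneralPosition_design hd hC hν n, h.ae_pi_label_mem_Icc] with D hx hy z
  exact ⟨sq_nonneg _, (sq_le_one_iff_abs_le_one _).2
    (abs_sub_le_one_of_mem_Icc (hx.cellInterp_mem_Icc hy z) (h.mem_Icc z))⟩

lemma integrable_sq_cellInterp_sub (h : IsRegression ν g) (hd : 1 ≤ d) (hC : MeasurableSet C)
    (hν : ν.map Prod.fst = cond volume C) :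
    Integrable (fun q : (Fin n → Pt d × ℝ) × Pt d =>
        (cellInterp (design q.1) (labels q.1) q.2 - g q.2) ^ 2)
      ((Measure.pi fun _ => ν).prod (cond volume C)) := by
  refine Integrable.of_mem_Icc 0 1
    ((measurable_cellInterp_design_labels.sub
      (h.measurable.comp measurable_snd)).pow_const 2).aemeasurable ?_
  filter_upwards [Measure.quasiMeasurePreserving_fst.ae (h.ae_sq_cellInterp_sub_mem_Icc hd hC hν)]
    with q hq using hq q.2

lemma setIntegral_prod_sq_cellInterp_sub_le (h : IsRegression ν g) (hd : 1 ≤ d)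
    (hC : MeasurableSet C) (hCconvex : Convex ℝ C) (hν : ν.map Prod.fst = cond volume C)
    (hε : 0 ≤ ε) (hδ : ∀ u ∈ C, ∀ z ∈ C, dist u z ≤ δ → |g u - g z| ≤ ε) (n : ℕ) :
    ∫ q in {q | (design q.1, q.2) ∈ smallCellSet d n δ},
        (cellInterp (design q.1) (labels q.1) q.2 - g q.2) ^ 2
          ∂((Measure.pi fun _ => ν).prod (cond volume C)) ≤
      2 / (d + 2) * (∫ z, bernoulliVar g z ∂(cond volume C) + ε) + ε ^ 2 := by
  have : IsProbabilityMeasure (cond volume C) :=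
    hν ▸ Measure.isProbabilityMeasure_map measurable_fst.aemeasurable
  have hpair : Measurable fun q : (Fin n → Pt d × ℝ) × Pt d => (design q.1, q.2) := by fun_prop
  have hG : MeasurableSet {q : (Fin n → Pt d × ℝ) × Pt d |
      (design q.1, q.2) ∈ smallCellSet d n δ} := (measurableSet_smallCellSet δ).preimage hpair
  have hcondMSE : IntegrableOn (fun q : (Fin n → Pt d × ℝ) × Pt d => condMSE g (design q.1) q.2)
      {q | (design q.1, q.2) ∈ smallCellSet d n δ}
      ((Measure.pi fun _ => ν).prod (cond volume C)) :=
    Integrable.of_mem_Icc 0 2 (h.measurable_condMSE.comp hpair).aemeasurable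
      (ae_restrict_of_forall_mem hG fun q hq => h.condMSE_mem_Icc hq)
  -- The noise is averaged at a fixed test point, the interpolation weights at a fixed design.
  refine (setIntegral_prod_eq_integral_setIntegral_symm hG
    (h.integrable_sq_cellInterp_sub hd hC hν).integrableOn).trans_le ?_
  refine (integral_congr_ae
    (Eventually.of_forall fun z => h.setIntegral_sq_cellInterp_sub δ z)).trans_le ?_
  refine (setIntegral_prod_eq_integral_setIntegral_symm hG hcondMSE).symm.trans_le ?_
  rw [setIntegral_prod_eq_integral_setIntegral hG hcondMSE]
  refine (integral_mono_of_nonneg (Eventually.of_forall fun D => ?_)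
    (integrable_const (2 / (d + 2) * (∫ z, bernoulliVar g z ∂(cond volume C) + ε) + ε ^ 2))
    ?_).trans_eq (by simp)
  · exact setIntegral_nonneg (hG.preimage measurable_prodMk_left)
      fun z hz => (h.condMSE_mem_Icc hz).1
  · filter_upwards [ae_inGeneralPosition_design hd hC hν n, ae_design_mem hC hν] with D hx hxC
    exact h.setIntegral_condMSE_le hCconvex hx hxC hε hδ

/-- Outside the small cells the squared error is at most `1`. -/
lemma integral_sq_cellInterp_sub_le (h : IsRegression ν g) (hd : 1 ≤ d) (hC : MeasurableSet C)
    (hCconvex : Convex ℝ C) (hν : ν.map Prod.fst = cond volume C) (hε : 0 ≤ ε)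
    (hδ : ∀ u ∈ C, ∀ z ∈ C, dist u z ≤ δ → |g u - g z| ≤ ε) (n : ℕ) :
    ∫ q, (cellInterp (design q.1) (labels q.1) q.2 - g q.2) ^ 2
        ∂((Measure.pi fun _ : Fin n => ν).prod (cond volume C)) ≤
      2 / (d + 2) * (∫ z, bernoulliVar g z ∂(cond volume C) + ε) + ε ^ 2 +
        ((Measure.pi fun _ : Fin n => ν).prod (cond volume C)).real
          {q | (design q.1, q.2) ∉ smallCellSet d n δ} := by
  have hG : MeasurableSet {q : (Fin n → Pt d × ℝ) × Pt d |
      (design q.1, q.2) ∈ smallCellSet d n δ} :=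
    (measurableSet_smallCellSet δ).preimage (by fun_prop)
  have hint := h.integrable_sq_cellInterp_sub hd hC hν (n := n)
  rw [← integral_add_compl hG hint]
  refine add_le_add (h.setIntegral_prod_sq_cellInterp_sub_le hd hC hCconvex hν hε hδ n) ?_
  refine (setIntegral_mono_ae hint.integrableOn (integrable_const 1).integrableOn ?_).trans_eq ?_
  · filter_upwards [Measure.quasiMeasurePreserving_fst.ae
      (h.ae_sq_cellInterp_sub_mem_Icc hd hC hν)] with q hq using (hq q.2).2
  · rw [setIntegral_const, smul_eq_mul, mul_one, Set.compl_ofPred]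

end IsRegression

end MeanSquaredError

section SmallCellProbability

variable {C : Set (Pt d)} {ν : Measure (Pt d × ℝ)} {δ ρ r : ℝ} {z : Pt d}
  {T : (n : ℕ) → (Fin n → Pt d) → Finset (Finset (Fin n))}

lemma smallCellSet_mono {δ' : ℝ} (hδ : δ ≤ δ') : smallCellSet d n δ ⊆ smallCellSet d n δ' :=
  fun _ ⟨hx, s, hs, hsδ⟩ => ⟨hx, s, hs, fun k l => (hsδ k l).trans hδ⟩

lemma ae_mem_interior_cond (hC : IsCompact C) (hCconvex : Convex ℝ C) :
    ∀ᵐ z ∂(cond volume C), z ∈ interior C := by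
  have hfrontier : ∀ᵐ z ∂(cond volume C), z ∉ frontier C :=
    cond_absolutelyContinuous.ae_le
      (measure_eq_zero_iff_ae_notMem.1 (hCconvex.addHaar_frontier volume))
  filter_upwards [hfrontier, ae_cond_mem hC.measurableSet] with z hz hzC
  by_contra hint
  exact hz (hC.isClosed.frontier_eq ▸ ⟨hzC, hint⟩)

lemma cond_compl_ball_lt_one (hC : IsCompact C) [IsProbabilityMeasure (cond volume C)]
    (hr : 0 < r) (hball : Metric.ball z r ⊆ C) : cond volume C (Metric.ball z r)ᶜ < 1 := by
  rw [prob_compl_eq_one_sub Metric.isOpen_ball.measurableSet]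
  refine ENNReal.sub_lt_self ENNReal.one_ne_top one_ne_zero ?_
  rw [cond_apply hC.measurableSet, Set.inter_eq_right.2 hball]
  exact mul_ne_zero (ENNReal.inv_ne_zero.2 hC.measure_lt_top.ne)
    (Metric.measure_ball_pos volume z hr).ne'

variable [IsProbabilityMeasure ν]

lemma pi_forall_design_mem {E : Type*} [MeasurableSpace E] (ν : Measure (E × ℝ))
    [IsProbabilityMeasure ν] {S : Set E} (hS : MeasurableSet S) :
    (Measure.pi fun _ : Fin n => ν) {D | ∀ i, design D i ∈ S} = ν.map Prod.fst S ^ n := by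
  have hpi : {D : Fin n → E × ℝ | ∀ i, design D i ∈ S} = Set.univ.pi fun _ => Prod.fst ⁻¹' S := by
    ext D
    simp [design]
  rw [hpi, Measure.pi_pi, Finset.prod_const, Finset.card_univ, Fintype.card_fin,
    Measure.map_apply measurable_fst hS]

lemma IsDelaunayScheme.measure_notMem_smallCellSet_le (hT : IsDelaunayScheme T)
    (hρ : 0 < ρ) {F : Finset (Pt d)}
    (hF : ∀ (n : ℕ) (x : Fin n → Pt d),
      (∀ q ∈ F, ∃ i, dist (x i) q < ρ / 2) → IsDenseNear x z ρ) (hn : d < n)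
    (hgeneral : ∀ᵐ D ∂(Measure.pi fun _ : Fin n => ν), InGeneralPosition (design D))
    (hfacets : ∀ᵐ D ∂(Measure.pi fun _ : Fin n => ν), IsOffFacets (design D) z) :
    (Measure.pi fun _ : Fin n => ν) {D | (design D, z) ∉ smallCellSet d n (2 * ρ)} ≤
      ∑ q ∈ F, ν.map Prod.fst (Metric.ball q (ρ / 2))ᶜ ^ n := by
  calc (Measure.pi fun _ : Fin n => ν) {D | (design D, z) ∉ smallCellSet d n (2 * ρ)}
      ≤ (Measure.pi fun _ : Fin n => ν)
          (⋃ q ∈ F, {D | ∀ i, design D i ∈ (Metric.ball q (ρ / 2))ᶜ}) := by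
        refine measure_mono_ae ?_
        filter_upwards [hgeneral, hfacets] with D hD hDz hbad
        by_contra hmeets
        have hmeets : ¬ D ∈ ⋃ q ∈ F, {D | ∀ i, design D i ∈ (Metric.ball q (ρ / 2))ᶜ} := hmeets
        simp only [Set.mem_iUnion, Set.mem_ofPred_eq, Set.mem_compl_iff, Metric.mem_ball,
          not_exists, not_forall, not_not] at hmeets
        exact hbad ((hT n _ (hD.affineSpan_eq_top hn)).mem_smallCellSet hD hDz hρ (hF n _ hmeets))
    _ ≤ ∑ q ∈ F, (Measure.pi fun _ : Fin n => ν)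
          {D | ∀ i, design D i ∈ (Metric.ball q (ρ / 2))ᶜ} := measure_biUnion_finset_le _ _
    _ = ∑ q ∈ F, ν.map Prod.fst (Metric.ball q (ρ / 2))ᶜ ^ n :=
        Finset.sum_congr rfl fun q _ =>
          pi_forall_design_mem ν Metric.isOpen_ball.measurableSet.compl

lemma ae_ae_isOffFacets_design (hd : 1 ≤ d) (hC : MeasurableSet C)
    (hν : ν.map Prod.fst = cond volume C) (n : ℕ) :
    ∀ᵐ z ∂(cond volume C), ∀ᵐ D ∂(Measure.pi fun _ : Fin n => ν), IsOffFacets (design D) z := by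
  refine (Measure.ae_ae_comm (p := fun D z => IsOffFacets (design D) z)
    (measurableSet_isOffFacets.preimage (f := fun q : (Fin n → Pt d × ℝ) × Pt d =>
      (design q.1, q.2)) (by fun_prop))).1 ?_
  filter_upwards [ae_inGeneralPosition_design hd hC hν n] with D hD
  exact cond_absolutelyContinuous.ae_le hD.ae_isOffFacets

/-- With probability tending to one, every ball of a finite net around an interior point contains a
data point. -/
lemma IsDelaunayScheme.tendsto_measure_notMem_smallCellSet (hT : IsDelaunayScheme T) (hd : 1 ≤ d)
    (hC : IsCompact C) (hν : ν.map Prod.fst = cond volume C) (hδ : 0 < δ) (hz : z ∈ interior C)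
    (hfacets : ∀ n, ∀ᵐ D ∂(Measure.pi fun _ : Fin n => ν), IsOffFacets (design D) z) :
    Tendsto (fun n => (Measure.pi fun _ : Fin n => ν) {D | (design D, z) ∉ smallCellSet d n δ})
      atTop (𝓝 0) := by
  have : IsProbabilityMeasure (cond volume C) :=
    hν ▸ Measure.isProbabilityMeasure_map measurable_fst.aemeasurable
  obtain ⟨r, hr, hrC⟩ := Metric.isOpen_iff.1 isOpen_interior z hz
  obtain ⟨ρ, hρ, hρmin⟩ := exists_between (lt_min (half_pos hr) (half_pos hδ))
  obtain ⟨hρr, hρδ⟩ := lt_min_iff.1 hρmin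
  obtain ⟨F, hFz, hF⟩ := exists_finset_isDenseNear z hρ
  have hball (q) (hq : q ∈ F) : Metric.ball q (ρ / 2) ⊆ C := fun u hu =>
    interior_subset (hrC (Metric.mem_ball.2 (by
      linarith [dist_triangle u q z, Metric.mem_ball.1 hu, hFz q hq])))
  have hpow : Tendsto (fun n => ∑ q ∈ F, ν.map Prod.fst (Metric.ball q (ρ / 2))ᶜ ^ n)
      atTop (𝓝 (∑ _q ∈ F, 0)) :=
    tendsto_finsetSum _ fun q hq => ENNReal.tendsto_pow_atTop_nhds_zero_of_lt_one
      (hν ▸ cond_compl_ball_lt_one hC (half_pos hρ) (hball q hq))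
  rw [Finset.sum_const_zero] at hpow
  refine tendsto_of_tendsto_of_tendsto_of_le_of_le' tendsto_const_nhds hpow
    (Eventually.of_forall fun n => zero_le) ?_
  filter_upwards [eventually_gt_atTop d] with n hn
  have hsub : smallCellSet d n (2 * ρ) ⊆ smallCellSet d n δ := smallCellSet_mono (by linarith)
  exact (measure_mono fun D (hD : (design D, z) ∉ _) hsmall => hD (hsub hsmall)).trans
    (hT.measure_notMem_smallCellSet_le hρ hF hn
      (ae_inGeneralPosition_design hd hC.measurableSet hν n) (hfacets n))

lemma IsDelaunayScheme.tendsto_prob_notMem_smallCellSet (hT : IsDelaunayScheme T) (hd : 1 ≤ d)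
    (hC : IsCompact C) (hCconvex : Convex ℝ C) (hν : ν.map Prod.fst = cond volume C)
    (hδ : 0 < δ) :
    Tendsto (fun n => ((Measure.pi fun _ : Fin n => ν).prod (cond volume C)).real
      {q | (design q.1, q.2) ∉ smallCellSet d n δ}) atTop (𝓝 0) := by
  have : IsProbabilityMeasure (cond volume C) :=
    hν ▸ Measure.isProbabilityMeasure_map measurable_fst.aemeasurable
  have hbad (n : ℕ) : MeasurableSet {q : (Fin n → Pt d × ℝ) × Pt d |
      (design q.1, q.2) ∉ smallCellSet d n δ} :=
    (measurableSet_smallCellSet δ).compl.preimage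
      (f := fun q : (Fin n → Pt d × ℝ) × Pt d => (design q.1, q.2)) (by fun_prop)
  have hlim : Tendsto (fun n => ∫⁻ z, (Measure.pi fun _ : Fin n => ν)
      {D | (design D, z) ∉ smallCellSet d n δ} ∂(cond volume C)) atTop
      (𝓝 (∫⁻ _, 0 ∂cond volume C)) := by
    refine tendsto_lintegral_of_dominated_convergence (fun _ => 1)
      (fun n => measurable_measure_prodMk_right (hbad n))
      (fun n => Eventually.of_forall fun z => prob_le_one) (by simp) ?_
    filter_upwards [ae_all_iff.2 (ae_ae_isOffFacets_design hd hC.measurableSet hν),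
      ae_mem_interior_cond hC hCconvex] with z hfacets hz
    exact hT.tendsto_measure_notMem_smallCellSet hd hC hν hδ hz hfacets
  rw [lintegral_zero] at hlim
  refine ((ENNReal.tendsto_toReal ENNReal.zero_ne_top).comp hlim).congr fun n => ?_
  rw [measureReal_def, Measure.prod_apply_symm (hbad n)]
  rfl

end SmallCellProbability

section RegressionFunction

lemma ae_condExp_mem_Icc {Ω : Type*} {m m0 : MeasurableSpace Ω} {P : Measure Ω} [IsFiniteMeasure P]
    (hm : m ≤ m0) {Y : Ω → ℝ} (hY : Measurable Y) {a b : ℝ} (hmem : ∀ᵐ ω ∂P, Y ω ∈ Set.Icc a b) :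
    ∀ᵐ ω ∂P, P[Y | m] ω ∈ Set.Icc a b := by
  have hint : Integrable Y P := Integrable.of_mem_Icc a b hY.aemeasurable hmem
  filter_upwards [condExp_mono (m := m) (integrable_const a) hint (hmem.mono fun _ h => h.1),
    condExp_mono (m := m) hint (integrable_const b) (hmem.mono fun _ h => h.2)] with ω ha hb
  rw [condExp_const hm] at ha hb
  exact ⟨ha, hb⟩

variable {Ω : Type*} [MeasurableSpace Ω] {P : Measure Ω} {Y : Ω → ℝ}

lemma IsSmoothOnSupport.continuousOn {μ : Measure (Pt d)} {η : Pt d → ℝ} {A α : ℝ} (hα : 0 < α)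
    (h : IsSmoothOnSupport μ η A α) : ContinuousOn η μ.support := by
  intro x hx
  have hlim : ContinuousAt (fun x' : Pt d => A * ‖x' - x‖ ^ α) x :=
    continuousAt_const.mul (ContinuousAt.rpow_const (by fun_prop) (Or.inr hα.le))
  rw [ContinuousWithinAt, tendsto_iff_dist_tendsto_zero]
  refine squeeze_zero' (Eventually.of_forall fun _ => dist_nonneg) ?_
    (by simpa [Real.zero_rpow hα.ne'] using hlim.tendsto.mono_left nhdsWithin_le_nhds)
  filter_upwards [self_mem_nhdsWithin] with x' hx' using h x' hx' x hx

lemma exists_continuous_mem_Icc_eqOn {α : Type*} [TopologicalSpace α] [NormalSpace α] {S : Set α}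
    (hS : IsClosed S) {η : α → ℝ} (hη : ContinuousOn η S) {a b : ℝ} (hab : a ≤ b) :
    ∃ g : α → ℝ, Continuous g ∧ (∀ z, g z ∈ Set.Icc a b) ∧
      ∀ z ∈ S, η z ∈ Set.Icc a b → g z = η z := by
  obtain ⟨G, hG⟩ := ContinuousMap.exists_restrict_eq hS ⟨S.domRestrict η, hη.domRestrict⟩
  refine ⟨fun z => Set.projIcc a b hab (G z),
    (continuous_projIcc.comp G.continuous).subtype_val, fun z => Subtype.coe_prop _,
    fun z hz hmem => ?_⟩
  have hGz : G z = η z := congrArg (fun f : C(S, ℝ) => f ⟨z, hz⟩) hG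
  simp only [hGz, Set.projIcc_of_mem hab hmem]

lemma integral_comp_mul_sub_condExp_eq_zero [IsFiniteMeasure P] {E : Type*} [MeasurableSpace E]
    {X : Ω → E} (hX : Measurable X) (hY : Integrable Y P) {ψ : E → ℝ} (hψ : Measurable ψ) {B : ℝ}
    (hB : ∀ z, |ψ z| ≤ B) :
    ∫ ω, ψ (X ω) * (Y ω - P[Y | MeasurableSpace.comap X inferInstance] ω) ∂P = 0 := by
  have hψB : ∀ᵐ ω ∂P, ‖ψ (X ω)‖ ≤ B := Eventually.of_forall fun ω => hB (X ω)
  have hψX : AEStronglyMeasurable (fun ω => ψ (X ω)) P := (hψ.comp hX).aestronglyMeasurable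
  have hψY : Integrable (fun ω => ψ (X ω) * Y ω) P := hY.bdd_mul hψX hψB
  have hpull := condExp_mul_of_stronglyMeasurable_left
    (hψ.comp (comap_measurable X)).stronglyMeasurable hψY hY
  have hcond := integral_condExp (μ := P) (f := (ψ ∘ X) * Y) hX.comap_le
  rw [integral_congr_ae hpull] at hcond
  simp only [mul_sub]
  rw [integral_sub hψY (integrable_condExp.bdd_mul hψX hψB)]
  exact sub_eq_zero.2 hcond.symm

lemma isRegression_map [IsProbabilityMeasure P] {E : Type*} [MeasurableSpace E] {X : Ω → E}
    (hX : Measurable X) (hY : Measurable Y) (hbinary : ∀ᵐ ω ∂P, Y ω = 0 ∨ Y ω = 1) {g : E → ℝ}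
    (hg : Measurable g) (hg01 : ∀ z, g z ∈ Set.Icc (0 : ℝ) 1)
    (hmean : (fun ω => g (X ω)) =ᵐ[P] P[Y | MeasurableSpace.comap X inferInstance]) :
    IsRegression (P.map fun ω => (X ω, Y ω)) g where
  measurable := hg
  mem_Icc := hg01
  binary := (ae_map_iff (hX.prodMk hY).aemeasurable
    ((measurableSet_eq_fun measurable_snd measurable_const).union
      (measurableSet_eq_fun measurable_snd measurable_const))).2 hbinary
  integral_mul_noise_eq_zero ψ B hψ hB := by
    have hYint : Integrable Y P := Integrable.of_mem_Icc 0 1 hY.aemeasurable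
      (hbinary.mono fun ω hω => by rcases hω with hω | hω <;> simp [hω])
    unfold noise
    rw [integral_map (hX.prodMk hY).aemeasurable (by fun_prop),
      ← integral_comp_mul_sub_condExp_eq_zero hX hYint hψ hB]
    refine integral_congr_ae ?_
    filter_upwards [hmean] with ω hω
    rw [hω]

lemma exists_continuous_isRegression [IsProbabilityMeasure P] {X : Ω → Pt d} (hX : Measurable X)
    (hY : Measurable Y) (hbinary : ∀ᵐ ω ∂P, Y ω = 0 ∨ Y ω = 1) {η : Pt d → ℝ}
    (hη : (fun ω => η (X ω)) =ᵐ[P] P[Y | MeasurableSpace.comap X inferInstance])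
    (hcont : ContinuousOn η (P.map X).support) :
    ∃ g : Pt d → ℝ, Continuous g ∧ IsRegression (P.map fun ω => (X ω, Y ω)) g ∧
      ∀ᵐ ω ∂P, g (X ω) = η (X ω) := by
  obtain ⟨g, hg, hg01, hgη⟩ :=
    exists_continuous_mem_Icc_eqOn Measure.isClosed_support hcont zero_le_one
  have hgX : ∀ᵐ ω ∂P, g (X ω) = η (X ω) := by
    filter_upwards [hη, ae_of_ae_map hX.aemeasurable (Measure.support_mem_ae (μ := P.map X)),
      ae_condExp_mem_Icc hX.comap_le hY
        (hbinary.mono fun ω hω => show Y ω ∈ Set.Icc (0 : ℝ) 1 by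
          rcases hω with hω | hω <;> simp [hω])] with ω hηω hsupp hmem
    exact hgη _ hsupp (hηω ▸ hmem)
  exact ⟨g, hg, isRegression_map hX hY hbinary hg.measurable hg01 (EventuallyEq.trans hgX hη), hgX⟩

end RegressionFunction

section ExcessRisk

variable {ν : Measure (Pt d × ℝ)} {g f h : Pt d → ℝ}

/-- The conditional probability that the classifier `f` errs at `z`, when `f` takes the values `0`
and `1` and the conditional mean of the label is `g`. -/
def condRisk (g f : Pt d → ℝ) (z : Pt d) : ℝ := f z * (1 - 2 * g z) + g z

lemma measurable_plugIn (hh : Measurable h) : Measurable (plugIn h) := by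
  classical
  exact Measurable.ite (measurableSet_lt measurable_const hh) measurable_const measurable_const

lemma plugIn_eq_zero_or_one (h : Pt d → ℝ) (z : Pt d) : plugIn h z = 0 ∨ plugIn h z = 1 :=
  (ite_eq_or_eq _ _ _).symm

lemma condRisk_plugIn_sub_le (g h : Pt d → ℝ) (z : Pt d) :
    condRisk g (plugIn h) z - condRisk g (plugIn g) z ≤ 2 * |h z - g z| := by
  unfold condRisk plugIn
  split_ifs <;> linarith [neg_abs_le (h z - g z), le_abs_self (h z - g z)]

lemma risk_eq_risk_map {Ω : Type*} [MeasurableSpace Ω] {P : Measure Ω} {X : Ω → Pt d} {Y : Ω → ℝ}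
    (hX : Measurable X) (hY : Measurable Y) (hf : Measurable f) :
    risk P X Y f = risk (P.map fun ω => (X ω, Y ω)) Prod.fst Prod.snd f :=
  (map_measureReal_apply (hX.prodMk hY)
    (measurableSet_eq_fun (hf.comp measurable_fst) measurable_snd).compl).symm

lemma risk_plugIn_congr {Ω : Type*} [MeasurableSpace Ω] {P : Measure Ω} {X : Ω → Pt d}
    {h h' : Pt d → ℝ} (Y : Ω → ℝ) (hh : ∀ᵐ ω ∂P, h (X ω) = h' (X ω)) :
    risk P X Y (plugIn h) = risk P X Y (plugIn h') := by
  refine measureReal_congr ?_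
  filter_upwards [hh] with ω hω
  change (plugIn h (X ω) ≠ Y ω) = (plugIn h' (X ω) ≠ Y ω)
  rw [plugIn, plugIn, hω]

namespace IsRegression

lemma condRisk_mem_Icc (hg : IsRegression ν g) (hf : ∀ z, f z = 0 ∨ f z = 1) (z : Pt d) :
    condRisk g f z ∈ Set.Icc (0 : ℝ) 1 := by
  have hgz := hg.mem_Icc z
  rcases hf z with hfz | hfz <;> rw [condRisk, hfz] <;> constructor <;> linarith [hgz.1, hgz.2]

lemma measurable_condRisk (hg : IsRegression ν g) (hf : Measurable f) :
    Measurable (condRisk g f) := by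
  have hgm := hg.measurable
  unfold condRisk
  fun_prop

lemma integrable_condRisk (hg : IsRegression ν g) (hf : Measurable f)
    (hf01 : ∀ z, f z = 0 ∨ f z = 1) (μ : Measure (Pt d)) [IsFiniteMeasure μ] :
    Integrable (condRisk g f) μ :=
  Integrable.of_mem_Icc 0 1 (hg.measurable_condRisk hf).aemeasurable
    (Eventually.of_forall (hg.condRisk_mem_Icc hf01))

variable [IsFiniteMeasure ν]

lemma integrable_mul_noise (hg : IsRegression ν g) {ψ : Pt d → ℝ} (hψ : Measurable ψ) {B : ℝ}
    (hB : ∀ z, |ψ z| ≤ B) : Integrable (fun q => ψ q.1 * noise g q) ν := by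
  have hnoise : Integrable (noise g) ν :=
    Integrable.of_bound hg.measurable_noise.aestronglyMeasurable 1 hg.ae_abs_noise_le_one
  exact hnoise.bdd_mul (hψ.comp measurable_fst).aestronglyMeasurable
    (Eventually.of_forall fun q => hB q.1)

lemma risk_eq_integral_condRisk (hg : IsRegression ν g) (hf : Measurable f)
    (hf01 : ∀ z, f z = 0 ∨ f z = 1) :
    risk ν Prod.fst Prod.snd f = ∫ z, condRisk g f z ∂(ν.map Prod.fst) := by
  have herror : MeasurableSet {q : Pt d × ℝ | f q.1 ≠ q.2} :=
    (measurableSet_eq_fun (hf.comp measurable_fst) measurable_snd).compl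
  have hψ : Measurable fun z => 1 - 2 * f z := by fun_prop
  have hψB (z) : |1 - 2 * f z| ≤ 1 := by rcases hf01 z with hz | hz <;> rw [hz] <;> norm_num
  have hsplit : {q : Pt d × ℝ | f q.1 ≠ q.2}.indicator 1 =ᵐ[ν]
      fun q => condRisk g f q.1 + (1 - 2 * f q.1) * noise g q := by
    filter_upwards [hg.binary] with q hq
    simp only [Set.indicator_apply, Set.mem_ofPred_eq, condRisk, noise, Pi.one_apply]
    rcases hq with hq | hq <;> rcases hf01 q.1 with hfq | hfq <;> rw [hq, hfq] <;> norm_num <;> ring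
  have hcond : Integrable (fun q => condRisk g f q.1) ν :=
    (hg.integrable_condRisk hf hf01 (ν.map Prod.fst)).comp_measurable measurable_fst
  rw [risk, ← integral_indicator_one herror, integral_congr_ae hsplit,
    integral_add hcond (hg.integrable_mul_noise hψ hψB),
    hg.integral_mul_noise_eq_zero _ 1 hψ hψB, add_zero,
    integral_map measurable_fst.aemeasurable (hg.measurable_condRisk hf).aestronglyMeasurable]

lemma risk_plugIn_sub_le (hg : IsRegression ν g) (hh : Measurable h)
    (hint : Integrable (fun z => |h z - g z|) (ν.map Prod.fst)) :
    risk ν Prod.fst Prod.snd (plugIn h) - risk ν Prod.fst Prod.snd (plugIn g) ≤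
      2 * ∫ z, |h z - g z| ∂(ν.map Prod.fst) := by
  have hcond {h : Pt d → ℝ} (hh : Measurable h) :=
    hg.integrable_condRisk (measurable_plugIn hh) (plugIn_eq_zero_or_one h) (ν.map Prod.fst)
  rw [hg.risk_eq_integral_condRisk (measurable_plugIn hh) (plugIn_eq_zero_or_one h),
    hg.risk_eq_integral_condRisk (measurable_plugIn hg.measurable) (plugIn_eq_zero_or_one g),
    ← integral_sub (hcond hh) (hcond hg.measurable), ← integral_const_mul]
  exact integral_mono ((hcond hh).sub (hcond hg.measurable)) (hint.const_mul 2)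
    (condRisk_plugIn_sub_le g h)

lemma integral_noise_sq (hg : IsRegression ν g) :
    ∫ q, noise g q ^ 2 ∂ν = ∫ z, bernoulliVar g z ∂(ν.map Prod.fst) := by
  have hψ : Measurable fun z => 1 - 2 * g z := (hg.measurable.const_mul 2).const_sub 1
  have hvar : Integrable (fun q => bernoulliVar g q.1) ν :=
    (hg.integrable_bernoulliVar (ν.map Prod.fst)).comp_measurable measurable_fst
  simp only [sq]
  rw [integral_congr_ae hg.ae_noise_sq,
    integral_add (hg.integrable_mul_noise hψ hg.abs_one_sub_two_mul_le_one) hvar,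
    hg.integral_mul_noise_eq_zero _ 1 hψ hg.abs_one_sub_two_mul_le_one, zero_add,
    integral_map measurable_fst.aemeasurable hg.measurable_bernoulliVar.aestronglyMeasurable]

end IsRegression

end ExcessRisk

section ExcessRiskOfInterpolation

variable {C : Set (Pt d)} {ν : Measure (Pt d × ℝ)} {g : Pt d → ℝ}
  {T : (n : ℕ) → (Fin n → Pt d) → Finset (Finset (Fin n))}

/-- The excess risk of the plug-in classifier of `cellInterp` on the sample `D`, for a test example
of law `ν` with regression function `g`. -/
def cellExcessRisk (ν : Measure (Pt d × ℝ)) (g : Pt d → ℝ) (D : Fin n → Pt d × ℝ) : ℝ :=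
  risk ν Prod.fst Prod.snd (plugIn (cellInterp (design D) (labels D))) -
    risk ν Prod.fst Prod.snd (plugIn g)

lemma abs_risk_sub_risk_le_one {Ω : Type*} [MeasurableSpace Ω] (P : Measure Ω)
    [IsProbabilityMeasure P] (X : Ω → Pt d) (Y : Ω → ℝ) (f f' : Pt d → ℝ) :
    |risk P X Y f - risk P X Y f'| ≤ 1 :=
  abs_sub_le_one_of_mem_Icc ⟨measureReal_nonneg, measureReal_le_one⟩
    ⟨measureReal_nonneg, measureReal_le_one⟩

lemma measurable_cellExcessRisk [SFinite ν] :
    Measurable (cellExcessRisk ν g : (Fin n → Pt d × ℝ) → ℝ) := by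
  have herror : MeasurableSet {q : (Fin n → Pt d × ℝ) × (Pt d × ℝ) |
      plugIn (cellInterp (design q.1) (labels q.1)) q.2.1 ≠ q.2.2} := by
    classical
    have hinterp : Measurable fun q : (Fin n → Pt d × ℝ) × (Pt d × ℝ) =>
        cellInterp (design q.1) (labels q.1) q.2.1 :=
      measurable_cellInterp_design_labels.comp
        (f := fun q : (Fin n → Pt d × ℝ) × (Pt d × ℝ) => (q.1, q.2.1)) (by fun_prop)
    exact (measurableSet_eq_fun (Measurable.ite (measurableSet_lt measurable_const hinterp)
      measurable_const measurable_const) (by fun_prop)).compl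
  exact (measurable_measure_prodMk_left herror).ennreal_toReal.sub_const _

lemma integrable_cellExcessRisk [IsProbabilityMeasure ν] (Q : Measure (Fin n → Pt d × ℝ))
    [IsFiniteMeasure Q] : Integrable (cellExcessRisk ν g) Q :=
  Integrable.of_bound measurable_cellExcessRisk.aestronglyMeasurable 1
    (Eventually.of_forall fun _ => abs_risk_sub_risk_le_one ν _ _ _ _)

lemma integral_abs_le_sqrt_integral_sq {α : Type*} [MeasurableSpace α] {μ : Measure α}
    [IsProbabilityMeasure μ] {f : α → ℝ} (hf : MemLp f 2 μ) :
    ∫ a, |f a| ∂μ ≤ √(∫ a, f a ^ 2 ∂μ) := by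
  have hvar := variance_nonneg |f| μ
  rw [variance_eq_sub hf.abs] at hvar
  simp only [Pi.pow_apply, Pi.abs_apply, sq_abs] at hvar
  exact Real.le_sqrt_of_sq_le (sub_nonneg.1 hvar)

namespace IsRegression

variable [IsProbabilityMeasure ν]

lemma memLp_cellInterp_sub (h : IsRegression ν g) (hd : 1 ≤ d) (hC : MeasurableSet C)
    (hν : ν.map Prod.fst = cond volume C) :
    MemLp (fun q : (Fin n → Pt d × ℝ) × Pt d => cellInterp (design q.1) (labels q.1) q.2 - g q.2) 2
      ((Measure.pi fun _ => ν).prod (cond volume C)) :=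
  (memLp_two_iff_integrable_sq (measurable_cellInterp_design_labels.sub
    (h.measurable.comp measurable_snd)).aestronglyMeasurable).2
    (h.integrable_sq_cellInterp_sub hd hC hν)

lemma cellExcessRisk_le (h : IsRegression ν g) {D : Fin n → Pt d × ℝ}
    (hD : Integrable (fun z => |cellInterp (design D) (labels D) z - g z|) (ν.map Prod.fst)) :
    cellExcessRisk ν g D ≤
      2 * ∫ z, |cellInterp (design D) (labels D) z - g z| ∂(ν.map Prod.fst) := by
  have hinterp : Measurable (cellInterp (design D) (labels D)) :=
    measurable_cellInterp_design_labels.comp (f := fun z => (D, z)) (by fun_prop)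
  exact h.risk_plugIn_sub_le hinterp hD

lemma integral_cellExcessRisk_le (h : IsRegression ν g) (hd : 1 ≤ d) (hC : MeasurableSet C)
    (hν : ν.map Prod.fst = cond volume C) (n : ℕ) :
    ∫ D, cellExcessRisk ν g D ∂(Measure.pi fun _ : Fin n => ν) ≤
      2 * √(∫ q, (cellInterp (design q.1) (labels q.1) q.2 - g q.2) ^ 2
        ∂((Measure.pi fun _ : Fin n => ν).prod (cond volume C))) := by
  have : IsProbabilityMeasure (cond volume C) :=
    hν ▸ Measure.isProbabilityMeasure_map measurable_fst.aemeasurable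
  have hLp := h.memLp_cellInterp_sub hd hC hν (n := n)
  have habs : Integrable (fun q : (Fin n → Pt d × ℝ) × Pt d =>
      |cellInterp (design q.1) (labels q.1) q.2 - g q.2|)
      ((Measure.pi fun _ => ν).prod (cond volume C)) := (hLp.integrable one_le_two).abs
  have hslice : ∀ᵐ D ∂(Measure.pi fun _ : Fin n => ν), cellExcessRisk ν g D ≤
      2 * ∫ z, |cellInterp (design D) (labels D) z - g z| ∂(cond volume C) := by
    filter_upwards [habs.prod_right_ae] with D hD
    simpa only [hν] using h.cellExcessRisk_le (D := D) (hν ▸ hD)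
  calc ∫ D, cellExcessRisk ν g D ∂(Measure.pi fun _ : Fin n => ν)
      ≤ ∫ D, 2 * ∫ z, |cellInterp (design D) (labels D) z - g z| ∂(cond volume C)
          ∂(Measure.pi fun _ : Fin n => ν) :=
        integral_mono_ae (integrable_cellExcessRisk _) (habs.integral_prod_left.const_mul 2) hslice
    _ = 2 * ∫ q, |cellInterp (design q.1) (labels q.1) q.2 - g q.2|
          ∂((Measure.pi fun _ : Fin n => ν).prod (cond volume C)) := by
        rw [integral_const_mul, integral_prod _ habs]
    _ ≤ 2 * √(∫ q, (cellInterp (design q.1) (labels q.1) q.2 - g q.2) ^ 2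
          ∂((Measure.pi fun _ : Fin n => ν).prod (cond volume C))) :=
        mul_le_mul_of_nonneg_left (integral_abs_le_sqrt_integral_sq hLp) zero_le_two

lemma eventually_integral_sq_cellInterp_sub_le (h : IsRegression ν g) (hg : ContinuousOn g C)
    (hT : IsDelaunayScheme T) (hd : 1 ≤ d) (hC : IsCompact C) (hCconvex : Convex ℝ C)
    (hν : ν.map Prod.fst = cond volume C) {b : ℝ}
    (hb : 2 / (d + 2) * ∫ z, bernoulliVar g z ∂(cond volume C) < b) :
    ∀ᶠ n in atTop, ∫ q, (cellInterp (design q.1) (labels q.1) q.2 - g q.2) ^ 2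
      ∂((Measure.pi fun _ : Fin n => ν).prod (cond volume C)) ≤ b := by
  have hε : ∀ᶠ ε : ℝ in 𝓝[>] 0,
      2 / (d + 2) * (∫ z, bernoulliVar g z ∂(cond volume C) + ε) + ε ^ 2 + ε < b := by
    have hcont : Continuous fun ε : ℝ =>
        2 / (d + 2) * (∫ z, bernoulliVar g z ∂(cond volume C) + ε) + ε ^ 2 + ε := by fun_prop
    exact (hcont.tendsto 0).eventually_lt_const (by simpa using hb) |>.filter_mono
      nhdsWithin_le_nhds
  obtain ⟨ε, hεb, hε0⟩ := (hε.and self_mem_nhdsWithin).exists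
  obtain ⟨δ, hδ, hgδ⟩ := Metric.uniformContinuousOn_iff_le.1
    (hC.uniformContinuousOn_of_continuous hg) ε hε0
  have hbad := hT.tendsto_prob_notMem_smallCellSet hd hC hCconvex hν hδ
  filter_upwards [hbad.eventually_le_const hε0] with n hn
  exact (h.integral_sq_cellInterp_sub_le hd hC.measurableSet hCconvex hν (le_of_lt hε0) hgδ n).trans
    ((add_le_add_right hn _).trans hεb.le)

lemma eventually_integral_cellExcessRisk_le (h : IsRegression ν g) (hg : ContinuousOn g C)
    (hT : IsDelaunayScheme T) (hd : 1 ≤ d) (hC : IsCompact C) (hCconvex : Convex ℝ C)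
    (hν : ν.map Prod.fst = cond volume C) {c : ℝ}
    (hc : √(8 / (d + 2) * ∫ z, bernoulliVar g z ∂(cond volume C)) < c) :
    ∀ᶠ n in atTop, ∫ D, cellExcessRisk ν g D ∂(Measure.pi fun _ : Fin n => ν) ≤ c := by
  have hc0 : 0 < c := (Real.sqrt_nonneg _).trans_lt hc
  have hb : 2 / (d + 2) * ∫ z, bernoulliVar g z ∂(cond volume C) < (c / 2) ^ 2 := by
    have hsq := (Real.sqrt_lt' hc0).1 hc
    have hfactor : 8 / ((d : ℝ) + 2) = 4 * (2 / (d + 2)) := by ring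
    rw [hfactor, mul_assoc] at hsq
    linarith
  filter_upwards [h.eventually_integral_sq_cellInterp_sub_le hg hT hd hC hCconvex hν hb] with n hn
  calc ∫ D, cellExcessRisk ν g D ∂(Measure.pi fun _ : Fin n => ν)
      ≤ 2 * √(∫ q, (cellInterp (design q.1) (labels q.1) q.2 - g q.2) ^ 2
          ∂((Measure.pi fun _ : Fin n => ν).prod (cond volume C))) :=
        h.integral_cellExcessRisk_le hd hC.measurableSet hν n
    _ ≤ 2 * √((c / 2) ^ 2) := by gcongr
    _ = c := by rw [Real.sqrt_sq (by positivity), mul_div_cancel₀ _ two_ne_zero]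

end IsRegression

end ExcessRiskOfInterpolation

section TrainingSample

variable {Ω : Type*} [MeasurableSpace Ω] {P : Measure Ω} {X : ℕ → Ω → Pt d} {Y : ℕ → Ω → ℝ}
  {C : Set (Pt d)} {g η : Pt d → ℝ} {T : (n : ℕ) → (Fin n → Pt d) → Finset (Finset (Fin n))}

/-- The training sample `(X 1, Y 1), …, (X n, Y n)`, as a random point of the product space on which
the deterministic analysis takes place; the index `0` is reserved for the test example. -/
def sample (X : ℕ → Ω → Pt d) (Y : ℕ → Ω → ℝ) (n : ℕ) (ω : Ω) : Fin n → Pt d × ℝ :=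
  fun i => (X (i + 1) ω, Y (i + 1) ω)

lemma measurable_sample (hX : ∀ i, Measurable (X i)) (hY : ∀ i, Measurable (Y i)) (n : ℕ) :
    Measurable (sample X Y n) :=
  measurable_pi_iff.2 fun i => (hX (i + 1)).prodMk (hY (i + 1))

lemma map_sample (hX : ∀ i, Measurable (X i)) (hY : ∀ i, Measurable (Y i))
    (hindep : iIndepFun (fun i ω => (X i ω, Y i ω)) P)
    (hident : ∀ i, IdentDistrib (fun ω => (X i ω, Y i ω)) (fun ω => (X 0 ω, Y 0 ω)) P P) (n : ℕ) :
    P.map (sample X Y n) = Measure.pi fun _ => P.map fun ω => (X 0 ω, Y 0 ω) := by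
  have hinj : Function.Injective fun i : Fin n => (i : ℕ) + 1 :=
    (add_left_injective 1).comp Fin.val_injective
  exact ((hindep.precomp hinj).map_fun_eq_pi_map fun i : Fin n =>
      ((hX (i + 1)).prodMk (hY (i + 1))).aemeasurable).trans
    (congrArg Measure.pi (funext fun i => (hident (i + 1)).map_eq))

lemma IsDelaunayScheme.risk_simplicialClassifier_sub_eq_cellExcessRisk (hT : IsDelaunayScheme T)
    (hX : Measurable (X 0)) (hY : Measurable (Y 0)) (hg : Measurable g)
    (hgη : ∀ᵐ ω ∂P, g (X 0 ω) = η (X 0 ω)) (hac : P.map (X 0) ≪ volume) (hn : d < n) {ω : Ω}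
    (hω : InGeneralPosition (design (sample X Y n ω))) :
    risk P (X 0) (Y 0) (simplicialClassifier T X Y n ω) - risk P (X 0) (Y 0) (plugIn η) =
      cellExcessRisk (P.map fun ω => (X 0 ω, Y 0 ω)) g (sample X Y n ω) := by
  have hdelaunay := hT n _ (hω.affineSpan_eq_top hn)
  have hinterp : ∀ᵐ ω' ∂P, simplicialInterp (T n (design (sample X Y n ω)))
      (design (sample X Y n ω)) (labels (sample X Y n ω)) (X 0 ω') =
        cellInterp (design (sample X Y n ω)) (labels (sample X Y n ω)) (X 0 ω') := by
    filter_upwards [ae_of_ae_map hX.aemeasurable (hac.ae_le hω.ae_isOffFacets)] with ω' hω'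
    exact hdelaunay.simplicialInterp_eq_cellInterp hω hω' _
  have hmeas : Measurable (cellInterp (design (sample X Y n ω)) (labels (sample X Y n ω))) :=
    measurable_cellInterp_design_labels.comp (f := fun z => (sample X Y n ω, z)) (by fun_prop)
  rw [cellExcessRisk, ← risk_eq_risk_map hX hY (measurable_plugIn hmeas),
    ← risk_eq_risk_map hX hY (measurable_plugIn hg), ← risk_plugIn_congr (Y 0) hinterp,
    risk_plugIn_congr (Y 0) hgη]
  rfl

lemma IsDelaunayScheme.ae_risk_simplicialClassifier_sub_eq_cellExcessRisk [IsProbabilityMeasure P]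
    (hT : IsDelaunayScheme T) (hd : 1 ≤ d) (hX : ∀ i, Measurable (X i))
    (hY : ∀ i, Measurable (Y i)) (hindep : iIndepFun (fun i ω => (X i ω, Y i ω)) P)
    (hident : ∀ i, IdentDistrib (fun ω => (X i ω, Y i ω)) (fun ω => (X 0 ω, Y 0 ω)) P P)
    (hg : Measurable g) (hgη : ∀ᵐ ω ∂P, g (X 0 ω) = η (X 0 ω)) (hC : MeasurableSet C)
    (hunif : P.map (X 0) = cond volume C) (hn : d < n) :
    (fun ω => risk P (X 0) (Y 0) (simplicialClassifier T X Y n ω) -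
      risk P (X 0) (Y 0) (plugIn η)) =ᵐ[P]
      fun ω => cellExcessRisk (P.map fun ω => (X 0 ω, Y 0 ω)) g (sample X Y n ω) := by
  have hXY := (hX 0).prodMk (hY 0)
  have := Measure.isProbabilityMeasure_map (μ := P) hXY.aemeasurable
  have hgeneral : ∀ᵐ D ∂(P.map (sample X Y n)), InGeneralPosition (design D) :=
    map_sample hX hY hindep hident n ▸ ae_inGeneralPosition_design hd hC
      ((Measure.map_map measurable_fst hXY).trans hunif) n
  filter_upwards [ae_of_ae_map (measurable_sample hX hY n).aemeasurable hgeneral] with ω hω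
  exact hT.risk_simplicialClassifier_sub_eq_cellExcessRisk (hX 0) (hY 0) hg hgη
    (hunif ▸ cond_absolutelyContinuous) hn hω

lemma IsRegression.integral_sq_sub_eq {X : Ω → Pt d} {Y : Ω → ℝ} (hX : Measurable X)
    (hY : Measurable Y) [IsProbabilityMeasure P]
    (hg : IsRegression (P.map fun ω => (X ω, Y ω)) g) (hgη : ∀ᵐ ω ∂P, g (X ω) = η (X ω)) :
    ∫ ω, (Y ω - η (X ω)) ^ 2 ∂P = ∫ z, bernoulliVar g z ∂(P.map X) := by
  have hXY := hX.prodMk hY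
  have := Measure.isProbabilityMeasure_map (μ := P) hXY.aemeasurable
  have hmap : (P.map fun ω => (X ω, Y ω)).map Prod.fst = P.map X :=
    Measure.map_map measurable_fst hXY
  rw [← hmap, ← hg.integral_noise_sq, integral_map hXY.aemeasurable
    (hg.measurable_noise.pow_const 2).aestronglyMeasurable]
  refine integral_congr_ae ?_
  filter_upwards [hgη] with ω hω
  rw [noise, hω]

end TrainingSample

lemma limsup_le_of_forall_gt_eventually_le {u : ℕ → ℝ} {a b : ℝ} (hlow : ∀ n, b ≤ u n)
    (h : ∀ c, a < c → ∀ᶠ n in atTop, u n ≤ c) : limsup u atTop ≤ a :=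
  le_of_forall_gt_imp_ge_of_dense fun c hc =>
    limsup_le_of_le (isCoboundedUnder_le_of_le atTop hlow) (h c hc)

lemma neg_one_le_integral {Ω : Type*} [MeasurableSpace Ω] {P : Measure Ω} [IsProbabilityMeasure P]
    {f : Ω → ℝ} (hf : ∀ ω, |f ω| ≤ 1) : -1 ≤ ∫ ω, f ω ∂P := by
  have hnorm := norm_integral_le_of_norm_le_const (μ := P) (f := f) (Eventually.of_forall hf)
  rw [probReal_univ, mul_one] at hnorm
  exact (abs_le.1 hnorm).1

end SimplicialRisk

end

open SimplicialRisk in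
theorem mainTheorem7_general {d : ℕ} (hd : 1 ≤ d)
    {Ω : Type*} [MeasurableSpace Ω] (P : Measure Ω) [IsProbabilityMeasure P]
    (X : ℕ → Ω → Pt d) (Y : ℕ → Ω → ℝ) (hX : ∀ i, Measurable (X i)) (hY : ∀ i, Measurable (Y i))
    (hindep : iIndepFun (fun i ω => (X i ω, Y i ω)) P)
    (hident : ∀ i, IdentDistrib (fun ω => (X i ω, Y i ω)) (fun ω => (X 0 ω, Y 0 ω)) P P)
    (hbinary : ∀ᵐ ω ∂P, Y 0 ω = 0 ∨ Y 0 ω = 1)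
    (η : Pt d → ℝ)
    (hη : (fun ω => η (X 0 ω)) =ᵐ[P] P[Y 0 | MeasurableSpace.comap (X 0) inferInstance])
    (hηcont : ContinuousOn η (P.map (X 0)).support)
    (C : Set (Pt d)) (hCcompact : IsCompact C) (hCconvex : Convex ℝ C)
    (hunif : pdf.IsUniform (X 0) C P volume)
    (T : (n : ℕ) → (Fin n → Pt d) → Finset (Finset (Fin n))) (hT : IsDelaunayScheme T) :
    (∀ n, d < n → Integrable (fun ω =>
      risk P (X 0) (Y 0) (simplicialClassifier T X Y n ω) - risk P (X 0) (Y 0) (plugIn η)) P) ∧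
    limsup (fun n : ℕ => ∫ ω, (risk P (X 0) (Y 0) (simplicialClassifier T X Y n ω) -
        risk P (X 0) (Y 0) (plugIn η)) ∂P) atTop ≤
      √(8 / ((d : ℝ) + 2) * ∫ ω, (Y 0 ω - η (X 0 ω)) ^ 2 ∂P) := by
  obtain ⟨g, hgcont, hg, hgη⟩ :=
    exists_continuous_isRegression (hX 0) (hY 0) hbinary hη hηcont
  have hXY := (hX 0).prodMk (hY 0)
  have := Measure.isProbabilityMeasure_map (μ := P) hXY.aemeasurable
  have hν : (P.map fun ω => (X 0 ω, Y 0 ω)).map Prod.fst = cond volume C :=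
    (Measure.map_map measurable_fst hXY).trans hunif
  have hexcess {n : ℕ} (hn : d < n) := hT.ae_risk_simplicialClassifier_sub_eq_cellExcessRisk hd hX
    hY hindep hident hg.measurable hgη hCcompact.measurableSet hunif hn
  refine ⟨fun n hn => ((integrable_cellExcessRisk (P.map (sample X Y n))).comp_measurable
    (measurable_sample hX hY n)).congr (hexcess hn).symm,
    limsup_le_of_forall_gt_eventually_le (fun n => neg_one_le_integral fun ω =>
      abs_risk_sub_risk_le_one P _ _ _ _) fun c hc => ?_⟩
  rw [hg.integral_sq_sub_eq (hX 0) (hY 0) hgη, hunif] at hc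
  filter_upwards [eventually_gt_atTop d, hg.eventually_integral_cellExcessRisk_le
    hgcont.continuousOn hT hd hCcompact hCconvex hν hc] with n hn hle
  rwa [integral_congr_ae (hexcess hn), ← integral_map (measurable_sample hX hY n).aemeasurable
    measurable_cellExcessRisk.aestronglyMeasurable, map_sample hX hY hindep hident]

/-- The test example `(X, Y)` is `(X 0, Y 0)`, the training data are `(X 1, Y 1), (X 2, Y 2), …`. -/
theorem mainTheorem7 {d : ℕ} (hd : 1 ≤ d)
    {Ω : Type*} [MeasurableSpace Ω] (P : Measure Ω) [IsProbabilityMeasure P]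
    (X : ℕ → Ω → SimplicialRisk.Pt d) (Y : ℕ → Ω → ℝ)
    (hX : ∀ i, Measurable (X i)) (hY : ∀ i, Measurable (Y i))
    (hindep : iIndepFun (fun i ω => (X i ω, Y i ω)) P)
    (hident : ∀ i, IdentDistrib (fun ω => (X i ω, Y i ω)) (fun ω => (X 0 ω, Y 0 ω)) P P)
    (hbinary : ∀ᵐ ω ∂P, Y 0 ω = 0 ∨ Y 0 ω = 1)
    -- `η` is the conditional mean and `v` the conditional variance of `Y` given `X`
    (η v : SimplicialRisk.Pt d → ℝ)
    (hη : (fun ω => η (X 0 ω)) =ᵐ[P] P[Y 0 | MeasurableSpace.comap (X 0) inferInstance])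
    (hv : (fun ω => v (X 0 ω)) =ᵐ[P] Var[Y 0; P | MeasurableSpace.comap (X 0) inferInstance])
    -- the law of `X` is uniform on a full-dimensional compact convex set
    (C : Set (SimplicialRisk.Pt d)) (hCcompact : IsCompact C) (hCconvex : Convex ℝ C)
    (hCfull : (interior C).Nonempty) (hunif : pdf.IsUniform (X 0) C P volume)
    (hsimple : SimplicialRisk.IsSimplePolytope (P.map (X 0)).support)
    (A α A' α' : ℝ) (hα : 0 < α) (hα' : 0 < α')
    (hηsmooth : SimplicialRisk.IsSmoothOnSupport (P.map (X 0)) η A α)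
    (hvsmooth : SimplicialRisk.IsSmoothOnSupport (P.map (X 0)) v A' α')
    (T : (n : ℕ) → (Fin n → SimplicialRisk.Pt d) → Finset (Finset (Fin n)))
    (hT : SimplicialRisk.IsDelaunayScheme T) :
    (∀ n, d < n → Integrable (fun ω =>
      SimplicialRisk.risk P (X 0) (Y 0) (SimplicialRisk.simplicialClassifier T X Y n ω)
        - SimplicialRisk.risk P (X 0) (Y 0) (SimplicialRisk.plugIn η)) P) ∧
    limsup (fun n : ℕ => ∫ ω,
      (SimplicialRisk.risk P (X 0) (Y 0) (SimplicialRisk.simplicialClassifier T X Y n ω)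
        - SimplicialRisk.risk P (X 0) (Y 0) (SimplicialRisk.plugIn η)) ∂P) atTop
      ≤ √(8 / ((d : ℝ) + 2) * ∫ ω, (Y 0 ω - η (X 0 ω)) ^ 2 ∂P) :=
  mainTheorem7_general hd P X Y hX hY hindep hident hbinary η hη (hηsmooth.continuousOn hα) C
    hCcompact hCconvex hunif T hT
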